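/- Let $B_0>0$ and $r_0>0$, let $\omega=\{x\in\mathbb{R}^2:|x|<r_0\}$, and let $A=(A_1,A_2):\mathbb{R}^2\to\mathbb{R}^2$ be a $C^1$ vector potential with $\partial_1A_2-\partial_2A_1=B_0$ on $\omega$. Let $H_\omega(A)=(i\nabla+A)^2$ be the magnetic Dirichlet Laplacian, that is, the operator in $L^2(\omega)$ associated with the closed quadratic form $\|(i\nabla+A)u\|_{L^2(\omega)}^2$, $u\in\mathcal{H}^1_0(\omega)$. Let $$M(a,b,x)=\sum_{j\ge0}\frac{(a)_j}{(b)_j}\frac{x^j}{j!}$$ be the Kummer function. Put $\alpha=\sqrt{B_0}\,r_0/\sqrt2$, so that $\alpha^2=B_0r_0^2/2$. Then for every integer $n\ge0$ the set of real $a$ with $M(a,n+1,\alpha^2)=0$ is infinite, consists of negative numbers, and can be enumerated as a strictly decreasing sequence $(a^k_{n,\alpha})_{k\in\mathbb{N}}$. The eigenvalues of $H_\omega(A)$ are exactly the numbers $$B_0+B_0\left(|m|-m-2a^k_{|m|,\alpha}\right),\qquad m\in\mathbb{Z},\ k\in\mathbb{N},$$ and they are counted with multiplicity: the dimension of the eigenspace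 of $H_\omega(A)$ for a number $\mu\in\mathbb{C}$ is the number of pairs $(m,k)\in\mathbb{Z}\times\mathbb{N}$ for which the expression above equals $\mu$. -/

import Mathlib

noncomputable section

namespace MagneticDisc

open MeasureTheory
open scoped ContDiff

/-- The Euclidean plane. -/
abbrev Plane : Type := EuclideanSpace ℝ (Fin 2)

/-- The complex Hilbert space `L²(Ω)`. -/
abbrev L2 (Ω : Set Plane) : Type := Lp ℂ 2 (volume.restrict Ω)

/-- The partial derivative of `φ` in the direction of the `j`-th coordinate. -/
def partialDeriv {F : Type*} [NormedAddCommGroup F] [NormedSpace ℝ F]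
    (j : Fin 2) (φ : Plane → F) (x : Plane) : F :=
  fderiv ℝ φ x (EuclideanSpace.single j 1)

/-- The magnetic field `∂₁A₂ - ∂₂A₁` generated by the vector potential `A = (A₁, A₂)`. -/
def magneticField (A : Plane → Plane) (x : Plane) : ℝ :=
  partialDeriv 0 (fun y => A y 1) x - partialDeriv 1 (fun y => A y 0) x

/-- The pairs `(φ, ∇φ)` for `φ ∈ C_c^∞(Ω)`, as elements of `L²(Ω) × L²(Ω)²`. -/
def testGraph (Ω : Set Plane) : Submodule ℂ (L2 Ω × (Fin 2 → L2 Ω)) where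
  carrier := {p | ∃ φ : Plane → ℂ, ContDiff ℝ ∞ φ ∧ HasCompactSupport φ ∧ tsupport φ ⊆ Ω ∧
    p.1 =ᵐ[volume.restrict Ω] φ ∧ ∀ j, p.2 j =ᵐ[volume.restrict Ω] partialDeriv j φ}
  zero_mem' := by
    refine ⟨0, contDiff_const, HasCompactSupport.zero, by simp, Lp.coeFn_zero _ _ _, fun j => ?_⟩
    filter_upwards [Lp.coeFn_zero ℂ 2 (volume.restrict Ω)] with x hx
    have h0 : fderiv ℝ (0 : Plane → ℂ) x = 0 := fderiv_const_apply (0 : ℂ)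
    simpa [partialDeriv, h0] using hx
  add_mem' := by
    rintro p q ⟨φ, hφ, cφ, sφ, e, d⟩ ⟨ψ, hψ, cψ, sψ, e', d'⟩
    refine ⟨φ + ψ, hφ.add hψ, cφ.add cψ,
      (tsupport_add φ ψ).trans (Set.union_subset sφ sψ), ?_, fun j => ?_⟩
    · filter_upwards [Lp.coeFn_add p.1 q.1, e, e'] with x h1 h2 h3
      rw [Prod.fst_add, h1, Pi.add_apply, h2, h3, Pi.add_apply]
    · filter_upwards [Lp.coeFn_add (p.2 j) (q.2 j), d j, d' j] with x h1 h2 h3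
      have := fderiv_add (hφ.differentiable (by simp) x) (hψ.differentiable (by simp) x)
      rw [Prod.snd_add, Pi.add_apply, h1, Pi.add_apply, h2, h3]
      simp [partialDeriv, this]
  smul_mem' := by
    rintro c p ⟨φ, hφ, cφ, sφ, e, d⟩
    refine ⟨c • φ, hφ.const_smul c, cφ.smul_left (f := fun _ => c),
      (closure_mono (Function.support_const_smul_subset c φ)).trans sφ, ?_, fun j => ?_⟩
    · filter_upwards [Lp.coeFn_smul c p.1, e] with x h1 h2
      rw [Prod.smul_fst, h1, Pi.smul_apply, h2, Pi.smul_apply]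
    · filter_upwards [Lp.coeFn_smul c (p.2 j), d j] with x h1 h2
      have := fderiv_const_smul (hφ.differentiable (by simp) x) c
      rw [Prod.smul_snd, Pi.smul_apply, h1, Pi.smul_apply, h2]
      simp [partialDeriv, this]

/-- The Sobolev space `H¹₀(Ω)`, the closure of `C_c^∞(Ω)` in the `H¹` norm, given as the graph
of its gradient: the pairs `(u, ∇u)` with `u ∈ H¹₀(Ω)`. -/
def sobolevGraph (Ω : Set Plane) : Submodule ℂ (L2 Ω × (Fin 2 → L2 Ω)) :=
  (testGraph Ω).topologicalClosure

/-- The graph of the magnetic gradient: the pairs `(u, (i∇ + A)u)` with `u ∈ H¹₀(Ω)`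
(and `(i∇ + A)u ∈ L²(Ω)²`, which is automatic when `A` is bounded on `Ω`). -/
def magneticGradientGraph (Ω : Set Plane) (A : Plane → Plane) :
    Submodule ℂ (L2 Ω × (Fin 2 → L2 Ω)) where
  carrier := {p | ∃ g : Fin 2 → L2 Ω, (p.1, g) ∈ sobolevGraph Ω ∧
    ∀ j, p.2 j =ᵐ[volume.restrict Ω] fun x => Complex.I * g j x + (A x j : ℂ) * p.1 x}
  zero_mem' := by
    refine ⟨0, (sobolevGraph Ω).zero_mem, fun j => ?_⟩
    filter_upwards [Lp.coeFn_zero ℂ 2 (volume.restrict Ω)] with x hx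
    simp only [Prod.fst_zero, Prod.snd_zero, Pi.zero_apply, hx, mul_zero, add_zero]
  add_mem' := by
    rintro p q ⟨g, hg, e⟩ ⟨g', hg', e'⟩
    refine ⟨g + g', (sobolevGraph Ω).add_mem hg hg', fun j => ?_⟩
    filter_upwards [Lp.coeFn_add p.1 q.1, Lp.coeFn_add (p.2 j) (q.2 j), Lp.coeFn_add (g j) (g' j),
      e j, e' j] with x h1 h2 h3 h4 h5
    simp only [Prod.fst_add, Prod.snd_add, Pi.add_apply, h1, h2, h3, h4, h5]
    ring
  smul_mem' := by
    rintro c p ⟨g, hg, e⟩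
    refine ⟨c • g, (sobolevGraph Ω).smul_mem c hg, fun j => ?_⟩
    filter_upwards [Lp.coeFn_smul c p.1, Lp.coeFn_smul c (p.2 j), Lp.coeFn_smul c (g j), e j]
      with x h1 h2 h3 h4
    simp only [Prod.smul_fst, Prod.smul_snd, Pi.smul_apply, h1, h2, h3, h4, smul_eq_mul]
    ring

/-- The graph of the operator associated with the quadratic form `‖(i∇ + A)u‖²` on `H¹₀(Ω)`:
the pairs `(u, f)` such that `u` is in the form domain and
`⟨(i∇ + A)v, (i∇ + A)u⟩ = ⟨v, f⟩` for every `v` in the form domain. -/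
def magneticDirichletGraph (Ω : Set Plane) (A : Plane → Plane) : Submodule ℂ (L2 Ω × L2 Ω) where
  carrier := {p | ∃ G : Fin 2 → L2 Ω, (p.1, G) ∈ magneticGradientGraph Ω A ∧
    ∀ q ∈ magneticGradientGraph Ω A, ∑ j, inner ℂ (q.2 j) (G j) = inner ℂ q.1 p.2}
  zero_mem' := ⟨0, (magneticGradientGraph Ω A).zero_mem, fun q _ => by simp⟩
  add_mem' := by
    rintro p q ⟨G, hG, e⟩ ⟨G', hG', e'⟩
    refine ⟨G + G', (magneticGradientGraph Ω A).add_mem hG hG', fun v hv => ?_⟩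
    simp only [Pi.add_apply, Prod.snd_add, inner_add_right, Finset.sum_add_distrib, e v hv, e' v hv]
  smul_mem' := by
    rintro c p ⟨G, hG, e⟩
    refine ⟨c • G, (magneticGradientGraph Ω A).smul_mem c hG, fun v hv => ?_⟩
    simp only [Pi.smul_apply, Prod.smul_snd, inner_smul_right, ← Finset.mul_sum, e v hv]

/-- For a continuous potential on an open set, the relation above is the graph of an operator. -/
theorem magneticDirichletGraph_single_valued {Ω : Set Plane} (hΩ : IsOpen Ω) {A : Plane → Plane}
    (hA : Continuous A) (p : L2 Ω × L2 Ω) (hp : p ∈ magneticDirichletGraph Ω A)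
    (hp0 : p.1 = 0) : p.2 = 0 := by
  obtain ⟨G, hG, hq⟩ := hp
  have hG0 : ∀ j, G j = 0 := by
    have h := hq _ hG
    rw [hp0, inner_zero_left] at h
    have h2 : ∑ j, ‖G j‖ ^ 2 = 0 := by
      have : ((∑ j, ‖G j‖ ^ 2 : ℝ) : ℂ) = 0 := by
        rw [← h]
        push_cast
        exact Finset.sum_congr rfl fun j _ => (inner_self_eq_norm_sq_to_K (𝕜 := ℂ) (G j)).symm
      exact_mod_cast this
    intro j
    have := (Finset.sum_eq_zero_iff_of_nonneg (fun j _ => sq_nonneg ‖G j‖)).1 h2 j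
      (Finset.mem_univ j)
    simpa using this
  have key : ∀ g : Plane → ℝ, ContDiff ℝ ∞ g → HasCompactSupport g → tsupport g ⊆ Ω →
      ∫ x, g x • p.2 x ∂(volume.restrict Ω) = 0 := by
    intro g hg cg sg
    let φ : Plane → ℂ := fun x => (g x : ℂ)
    have hφ : ContDiff ℝ ∞ φ := Complex.ofRealCLM.contDiff.comp hg
    have cφ : HasCompactSupport φ := cg.comp_left (g := fun t : ℝ => (t : ℂ)) (by simp)
    have sφ : tsupport φ ⊆ Ω := (closure_mono
      (Function.support_comp_subset (g := fun t : ℝ => (t : ℂ)) (by simp) g)).trans sg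
    have mφ : MemLp φ 2 (volume.restrict Ω) := hφ.continuous.memLp_of_hasCompactSupport cφ
    have cd : ∀ j, Continuous (partialDeriv j φ) := fun j =>
      (hφ.continuous_fderiv (by simp)).clm_apply continuous_const
    have kd : ∀ j, HasCompactSupport (partialDeriv j φ) := fun j =>
      (cφ.fderiv (𝕜 := ℝ)).comp_left
        (g := fun L : Plane →L[ℝ] ℂ => L (EuclideanSpace.single j 1)) (by simp)
    have md : ∀ j, MemLp (partialDeriv j φ) 2 (volume.restrict Ω) := fun j =>
      (cd j).memLp_of_hasCompactSupport (kd j)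
    have mm : ∀ j, MemLp (fun x => Complex.I * partialDeriv j φ x + (A x j : ℂ) * φ x) 2
        (volume.restrict Ω) := by
      intro j
      have cA : Continuous fun x => (A x j : ℂ) := by fun_prop
      refine ((md j).const_mul _).add ?_
      exact (cA.mul hφ.continuous).memLp_of_hasCompactSupport cφ.mul_left
    have mem : (mφ.toLp φ, fun j => (mm j).toLp _) ∈ magneticGradientGraph Ω A := by
      refine ⟨fun j => (md j).toLp _, subset_closure
        ⟨φ, hφ, cφ, sφ, mφ.coeFn_toLp, fun j => (md j).coeFn_toLp⟩, fun j => ?_⟩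
      filter_upwards [(mm j).coeFn_toLp, (md j).coeFn_toLp, mφ.coeFn_toLp] with x h1 h2 h3
      rw [h1, h2, h3]
    have h := hq _ mem
    simp only [hG0, inner_zero_right, Finset.sum_const_zero] at h
    rw [L2.inner_def] at h
    rw [h]
    refine integral_congr_ae ?_
    filter_upwards [mφ.coeFn_toLp] with x hx
    simp [hx, φ, mul_comm]
  have hloc : LocallyIntegrableOn (p.2 : Plane → ℂ) Ω volume :=
    locallyIntegrableOn_of_locallyIntegrable_restrict
      ((Lp.memLp p.2).locallyIntegrable (by norm_num))
  have h := hΩ.ae_eq_zero_of_integral_contDiff_smul_eq_zero hloc fun g hg cg sg => by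
    rw [← key g hg cg sg, setIntegral_eq_integral_of_forall_compl_eq_zero]
    intro x hx
    rw [image_eq_zero_of_notMem_tsupport (fun h => hx (sg h)), zero_smul]
  rw [Lp.eq_zero_iff_ae_eq_zero]
  exact (ae_restrict_iff' hΩ.measurableSet).2 h

/-- The magnetic Dirichlet Laplacian `H_Ω(A) = (i∇ + A)²`, an unbounded operator in `L²(Ω)`. -/
def magneticDirichletLaplacian (Ω : Set Plane) (A : Plane → Plane) : L2 Ω →ₗ.[ℂ] L2 Ω :=
  (magneticDirichletGraph Ω A).toLinearPMap

/-- The eigenspace of an unbounded operator `H` for the number `μ`. -/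
def eigenspace {E : Type*} [AddCommGroup E] [Module ℂ E] (H : E →ₗ.[ℂ] E) (μ : ℂ) :
    Submodule ℂ E where
  carrier := {u | ∃ h : u ∈ H.domain, H ⟨u, h⟩ = μ • u}
  zero_mem' := ⟨H.domain.zero_mem, by
    have : (⟨0, H.domain.zero_mem⟩ : H.domain) = 0 := rfl
    rw [this, LinearPMap.map_zero, smul_zero]⟩
  add_mem' := by
    rintro u v ⟨hu, eu⟩ ⟨hv, ev⟩
    refine ⟨H.domain.add_mem hu hv, ?_⟩
    rw [smul_add, ← eu, ← ev, ← LinearPMap.map_add]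
    rfl
  smul_mem' := by
    rintro c u ⟨hu, eu⟩
    refine ⟨H.domain.smul_mem c hu, ?_⟩
    rw [smul_comm, ← eu, ← LinearPMap.map_smul]
    rfl

/-- `μ` is an eigenvalue of the unbounded operator `H`. -/
def IsEigenvalue {E : Type*} [AddCommGroup E] [Module ℂ E] (H : E →ₗ.[ℂ] E) (μ : ℂ) : Prop :=
  ∃ u : H.domain, u ≠ 0 ∧ H u = μ • (u : E)

/-- The Kummer function `M(a, b, x) = ∑ₖ (a)ₖ / (b)ₖ · xᵏ / k!`. -/
def kummerM (a b x : ℝ) : ℝ :=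
  ∑' k : ℕ, (ascPochhammer ℝ k).eval a / (ascPochhammer ℝ k).eval b * (x ^ k / (k.factorial : ℝ))

/-- The parameter values `a⁰ > a¹ > a² > …` with `M(a, n + 1, α²) = 0`, in decreasing order. -/
def kummerZero (n : ℕ) (α : ℝ) : ℕ → ℝ
  | 0 => sSup {a : ℝ | kummerM a (n + 1) (α ^ 2) = 0}
  | k + 1 => sSup {a : ℝ | a < kummerZero n α k ∧ kummerM a (n + 1) (α ^ 2) = 0}

/-- The number `B₀ + B₀ (|m| - m - 2 aᵏ)`, where `aᵏ` belongs to `|m|` and `α = √B₀ r₀ / √2`. -/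
def discEigenvalue (B₀ r₀ : ℝ) (m : ℤ) (k : ℕ) : ℝ :=
  B₀ + B₀ * (|(m : ℝ)| - m - 2 * kummerZero m.natAbs (√B₀ * r₀ / √2) k)

end MagneticDisc

end

open MagneticDisc

noncomputable section

namespace MagneticDisc

open MeasureTheory
open scoped ContDiff

open Filter Topology

/-! On the disc the 1-form given by `A` minus the symmetric-gauge potential of the constant field is
closed, hence exact. Its primitive `φ` gives a unimodular factor `E = exp(iφ)` that intertwines the
two magnetic gradients (`exists_isGauge`), so only the symmetric gauge needs computing. There the
operator respects angular momentum: on `r^|m| e^{imθ} e^{-Br²/4} g(s)`, with `s = Br²/2`, it acts as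
`g ↦ B(|m| + 1 - m) g - 2B (s g'' + (|m| + 1 - s) g')` (`IsGauge.mode_mem_graph`). The eigenvalue
equation for `μ` thus becomes Kummer's equation with `a = modeParam B μ m`. Its solution `M(a, |m| +
1, s)` satisfies the Dirichlet condition exactly when it vanishes at `s = α²`.

That nothing else occurs is shown by duality, without regularity theory for eigenfunctions. If `u`
is an eigenfunction for a real `μ`, symmetry of the operator makes `u` orthogonal to every mode
whose radial factor `h` is the image under the Kummer operator of some `g` with `g(α²) = 0`
(`IsGauge.inner_mode_eq_zero_of_solvesKummer`). Power series solve the Kummer equation with any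
monomial on the right. If `M(a, |m| + 1, α²) ≠ 0`, a multiple of `M` corrects the boundary value,
and `u` is orthogonal to all monomial modes of that `m`. Otherwise at most one condition is lost,
and a single moment of `u` determines whether the others vanish
(`IsGauge.exists_pow_determines_mode`). Monomial modes are total by Stone-Weierstrass
(`IsGauge.eq_zero_of_inner_mode`), so the multiplicity of `μ` is at most the number of resonant `m`.
The Kummer modes, orthogonal for distinct `m`, give equality (`IsGauge.rank_eigenspace`). For given
`μ` and `m` the parameter `a` is fixed, so each resonant `m` carries exactly one `k`.

The zeros in `a` are negative because `M ≥ 1` for `a ≥ 0`, and locally finite because `M` is entire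
in `a`. They are unbounded below because the contiguous relation along `a = -k` has no solution of
eventually constant sign (`exists_kummerM_zero_lt`). -/

/-! ### Entire power series and the inhomogeneous Kummer equation -/

/-- The sum of the power series with coefficients `c`. -/
def powSum (c : ℕ → ℝ) (s : ℝ) : ℝ := ∑' j, c j * s ^ j

/-- The power series with coefficients `c` converges everywhere. -/
def IsEntireSeq (c : ℕ → ℝ) : Prop := ∀ r : ℝ, Summable fun j => c j * r ^ j

/-- The coefficients of the derivative of a power series. -/
def derivSeq (c : ℕ → ℝ) (j : ℕ) : ℝ := (j + 1) * c (j + 1)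

/-- The factor `j` is absorbed by `2 ^ j`, so absolute convergence at the larger radius `2 (|r| +
1)` dominates. -/
theorem IsEntireSeq.summable_nat_mul {c : ℕ → ℝ} (hc : IsEntireSeq c) (r : ℝ) :
    Summable fun j : ℕ => c j * (j * r ^ (j - 1)) := by
  have h := (hc (2 * (|r| + 1))).norm
  refine Summable.of_norm_bounded h fun j => ?_
  rw [norm_mul, norm_mul (c j)]
  refine mul_le_mul_of_nonneg_left ?_ (norm_nonneg (c j))
  rw [norm_mul, norm_pow, norm_pow, Real.norm_eq_abs r, Real.norm_natCast, Real.norm_eq_abs,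
    abs_of_pos (show 0 < 2 * (|r| + 1) by positivity), mul_pow]
  have h1 : (j : ℝ) ≤ 2 ^ j := by exact_mod_cast Nat.lt_two_pow_self.le
  have h2 : |r| ^ (j - 1) ≤ (|r| + 1) ^ j :=
    (pow_le_pow_left₀ (abs_nonneg r) (by linarith) _).trans
      (pow_le_pow_right₀ (by linarith [abs_nonneg r]) (Nat.sub_le _ _))
  exact mul_le_mul h1 h2 (by positivity) (by positivity)

theorem IsEntireSeq.derivSeq {c : ℕ → ℝ} (hc : IsEntireSeq c) : IsEntireSeq (derivSeq c) := by
  intro r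
  refine ((summable_nat_add_iff 1).2 (hc.summable_nat_mul r)).congr fun j => ?_
  simp [MagneticDisc.derivSeq]
  ring

theorem IsEntireSeq.hasSum {c : ℕ → ℝ} (hc : IsEntireSeq c) (s : ℝ) :
    HasSum (fun j => c j * s ^ j) (powSum c s) := (hc s).hasSum

theorem IsEntireSeq.hasDerivAt {c : ℕ → ℝ} (hc : IsEntireSeq c) (s : ℝ) :
    HasDerivAt (powSum c) (powSum (MagneticDisc.derivSeq c) s) s := by
  have key := hasDerivAt_tsum_of_isPreconnected (g := fun (j : ℕ) (y : ℝ) => c j * y ^ j)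
    (g' := fun (j : ℕ) (y : ℝ) => c j * (j * y ^ (j - 1)))
    (hc.summable_nat_mul (|s| + 1)).norm (Metric.isOpen_ball (x := (0 : ℝ)) (ε := |s| + 1))
    (convex_ball _ _).isPreconnected (fun j y _ => (hasDerivAt_pow j y).const_mul _)
    (fun j y hy => by
      rw [norm_mul, norm_mul, norm_mul, norm_mul, norm_pow, norm_pow]
      gcongr
      rw [mem_ball_zero_iff] at hy
      rw [Real.norm_eq_abs (|s| + 1), abs_of_pos (show 0 < |s| + 1 by positivity)]
      exact hy.le) (y₀ := s) (by simp) (hc s) (y := s) (by simp)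
  have h : powSum (MagneticDisc.derivSeq c) s = ∑' j : ℕ, c j * (j * s ^ (j - 1)) := by
    rw [(hc.summable_nat_mul s).tsum_eq_zero_add]
    simp only [powSum, MagneticDisc.derivSeq, Nat.cast_zero, zero_mul, mul_zero, zero_add,
      Nat.cast_add, Nat.cast_one, Nat.add_sub_cancel]
    exact tsum_congr fun j => by ring
  rw [h]
  exact key

/-- The coefficients of the power series solution of `s g'' + (b - s) g' - a g = ∑ hⱼ sʲ` with
`g 0 = c`. -/
def frobCoeff (a b : ℝ) (h : ℕ → ℝ) (c : ℝ) : ℕ → ℝ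
  | 0 => c
  | j + 1 => ((a + j) * frobCoeff a b h c j + h j) / ((j + 1) * (b + j))

/-- Once the right-hand side has died out the recursion is homogeneous and the ratio of successive
coefficients is `O(1/j)`. -/
theorem isEntireSeq_frobCoeff {a b : ℝ} (hb : 0 < b) {h : ℕ → ℝ} (hh : ∀ᶠ j in atTop, h j = 0)
    (c : ℝ) : IsEntireSeq (frobCoeff a b h c) := by
  intro r
  refine summable_of_ratio_norm_eventually_le (r := 1 / 2) (by norm_num) ?_
  -- From this index on, `|a + j| |r| ≤ (|a| + 1)(j + 1)|r| ≤ (j + 1)(b + j)/2`.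
  filter_upwards [hh, eventually_ge_atTop (⌈2 * |r| * (|a| + 1)⌉₊ + 1)] with j hj hj2
  have hj3 : 2 * |r| * (|a| + 1) ≤ j :=
    (Nat.le_ceil _).trans (by exact_mod_cast (Nat.le_succ _).trans hj2)
  have hj0 : (0 : ℝ) ≤ j := by positivity
  simp only [frobCoeff, hj, add_zero, pow_succ, norm_mul, norm_div, norm_pow, Real.norm_eq_abs]
  have e1 : |(j : ℝ) + 1| = j + 1 := abs_of_pos (by positivity)
  have e2 : |b + (j : ℝ)| = b + j := abs_of_pos (by positivity)
  have e3 : |a + (j : ℝ)| ≤ (|a| + 1) * (j + 1) := by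
    refine (abs_add_le _ _).trans ?_
    rw [abs_of_nonneg hj0]
    nlinarith [abs_nonneg a]
  rw [e1, e2]
  have key : |a + (j : ℝ)| / ((j + 1) * (b + j)) * |r| ≤ 1 / 2 := by
    rw [div_mul_eq_mul_div, div_le_iff₀ (by positivity)]
    have := mul_le_mul_of_nonneg_right e3 (abs_nonneg r)
    nlinarith [abs_nonneg a, abs_nonneg r]
  calc _ = (|a + (j : ℝ)| / ((j + 1) * (b + j)) * |r|) * (|frobCoeff a b h c j| * |r| ^ j) := by
        ring
    _ ≤ _ := mul_le_mul_of_nonneg_right key (by positivity)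

/-- The inhomogeneous Kummer equation. -/
theorem powSum_frobCoeff_ode {a b : ℝ} (hb : 0 < b) {h : ℕ → ℝ} (hh : ∀ᶠ j in atTop, h j = 0)
    (c s : ℝ) :
    s * powSum (derivSeq (derivSeq (frobCoeff a b h c))) s
      + (b - s) * powSum (derivSeq (frobCoeff a b h c)) s - a * powSum (frobCoeff a b h c) s
      = powSum h s := by
  set k := frobCoeff a b h c with hk
  have e := isEntireSeq_frobCoeff (a := a) hb hh c
  rw [← hk] at e
  have h0 := e.hasSum s
  have h1 := e.derivSeq.hasSum s
  have h2 : HasSum (fun j : ℕ => j * ((j + 1) * k (j + 1)) * s ^ j)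
      (s * powSum (derivSeq (derivSeq k)) s) := by
    refine (hasSum_nat_add_iff' 1).1 ?_
    have := (e.derivSeq.derivSeq.hasSum s).mul_left s
    rw [Finset.sum_range_one, Nat.cast_zero, zero_mul, zero_mul, sub_zero]
    convert this using 2 with j
    · rfl
    simp only [derivSeq]
    push_cast
    ring
  have h3 : HasSum (fun j : ℕ => j * k j * s ^ j) (s * powSum (derivSeq k) s) := by
    refine (hasSum_nat_add_iff' 1).1 ?_
    have := (e.derivSeq.hasSum s).mul_left s
    rw [Finset.sum_range_one, Nat.cast_zero, zero_mul, zero_mul, sub_zero]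
    convert this using 2 with j
    · rfl
    simp only [derivSeq]
    push_cast
    ring
  have h4 := (h2.add (h1.mul_left b)).sub (h3.add (h0.mul_left a))
  have h5 : (fun j : ℕ => j * ((j + 1) * k (j + 1)) * s ^ j + b * (derivSeq k j * s ^ j) -
      (j * k j * s ^ j + a * (k j * s ^ j))) = fun j => h j * s ^ j := by
    funext j
    have hbj : b + (j : ℝ) ≠ 0 := by positivity
    have : k (j + 1) = ((a + j) * k j + h j) / ((j + 1) * (b + j)) := rfl
    have hj : ((j : ℝ) + 1) * (b + j) * k (j + 1) = (a + j) * k j + h j := by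
      rw [this]
      field_simp
    simp only [derivSeq]
    linear_combination s ^ j * hj
  rw [h5] at h4
  rw [powSum.eq_def h, h4.tsum_eq]
  ring

theorem frobCoeff_zero_one (a : ℝ) {b : ℝ} (hb : 0 < b) (k : ℕ) : frobCoeff a b 0 1 k =
    (ascPochhammer ℝ k).eval a / (ascPochhammer ℝ k).eval b / (k.factorial : ℝ) := by
  induction k with
  | zero => simp [frobCoeff]
  | succ k ih =>
    have := (ascPochhammer_pos k b hb).ne'
    have h2 : b + k ≠ 0 := by positivity
    rw [frobCoeff, ih, ascPochhammer_succ_eval, ascPochhammer_succ_eval, Nat.factorial_succ]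
    push_cast
    simp only [Pi.zero_apply, add_zero]
    field_simp

theorem kummerM_eq_powSum (a x : ℝ) {b : ℝ} (hb : 0 < b) :
    kummerM a b x = powSum (frobCoeff a b 0 1) x := by
  simp only [kummerM, powSum]
  refine tsum_congr fun k => ?_
  rw [frobCoeff_zero_one a hb]
  ring

theorem powSum_zero_seq (s : ℝ) : powSum 0 s = 0 := by simp [powSum]

theorem powSum_single (p : ℕ) (s : ℝ) : powSum (Pi.single p 1) s = s ^ p := by
  rw [powSum, tsum_eq_single p]
  · simp
  · intro j hj
    simp [hj]

theorem eventually_single_eq_zero (p : ℕ) :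
    ∀ᶠ j in atTop, (Pi.single p 1 : ℕ → ℝ) j = 0 := by
  filter_upwards [eventually_gt_atTop p] with j hj
  simp [hj.ne']

theorem powSum_apply_zero (c : ℕ → ℝ) : powSum c 0 = c 0 := by
  rw [powSum, tsum_eq_single 0]
  · simp
  · intro j hj
    simp [hj]

/-- `g` is twice continuously differentiable and solves `s g'' + (b - s) g' - a g = h`. -/
def SolvesKummer (a b : ℝ) (g h : ℝ → ℝ) : Prop :=
  ∃ g₁ g₂ : ℝ → ℝ, (∀ s, HasDerivAt g (g₁ s) s) ∧ (∀ s, HasDerivAt g₁ (g₂ s) s) ∧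
    Continuous g₂ ∧ ∀ s, s * g₂ s + (b - s) * g₁ s - a * g s = h s

theorem SolvesKummer.linear_comb {a b : ℝ} {g h g' h' : ℝ → ℝ} (H : SolvesKummer a b g h)
    (H' : SolvesKummer a b g' h') (c d : ℝ) :
    SolvesKummer a b (fun s => c * g s + d * g' s) (fun s => c * h s + d * h' s) := by
  obtain ⟨g₁, g₂, h1, h2, h3, h4⟩ := H
  obtain ⟨k₁, k₂, l1, l2, l3, l4⟩ := H'
  refine ⟨fun s => c * g₁ s + d * k₁ s, fun s => c * g₂ s + d * k₂ s,
    fun s => ((h1 s).const_mul c).add ((l1 s).const_mul d),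
    fun s => ((h2 s).const_mul c).add ((l2 s).const_mul d), by fun_prop, fun s => ?_⟩
  linear_combination c * h4 s + d * l4 s

theorem solvesKummer_powSum {a b : ℝ} (hb : 0 < b) {h : ℕ → ℝ} (hh : ∀ᶠ j in atTop, h j = 0)
    (c : ℝ) : SolvesKummer a b (powSum (frobCoeff a b h c)) (powSum h) := by
  have e := isEntireSeq_frobCoeff (a := a) hb hh c
  exact ⟨_, _, e.hasDerivAt, e.derivSeq.hasDerivAt,
    continuous_iff_continuousAt.2 fun s => (e.derivSeq.derivSeq.hasDerivAt s).continuousAt,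
    powSum_frobCoeff_ode hb hh c⟩

theorem solvesKummer_kummerM (a : ℝ) {b : ℝ} (hb : 0 < b) :
    SolvesKummer a b (kummerM a b) 0 := by
  have := solvesKummer_powSum (a := a) hb (h := 0) (by simp) 1
  rw [← show kummerM a b = powSum (frobCoeff a b 0 1) from
    funext fun s => kummerM_eq_powSum a s hb] at this
  rwa [show powSum 0 = 0 from funext powSum_zero_seq] at this

theorem kummerM_apply_zero (a : ℝ) {b : ℝ} (hb : 0 < b) : kummerM a b 0 = 1 := by
  rw [kummerM_eq_powSum a 0 hb, powSum_apply_zero, frobCoeff]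

/-- No boundary value is prescribed here: it is corrected later, by adding multiples of other
solutions. -/
theorem exists_solvesKummer_pow (a : ℝ) {b : ℝ} (hb : 0 < b) (p : ℕ) :
    ∃ g, SolvesKummer a b g (fun s => s ^ p) := by
  have := solvesKummer_powSum (a := a) hb (eventually_single_eq_zero p) 0
  rw [funext (powSum_single p)] at this
  exact ⟨_, this⟩

/-! ### Zeros of the Kummer function in its first parameter -/

theorem summable_kummerM (a x : ℝ) {b : ℝ} (hb : 0 < b) : Summable fun k : ℕ =>
    (ascPochhammer ℝ k).eval a / (ascPochhammer ℝ k).eval b * (x ^ k / (k.factorial : ℝ)) := by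
  refine (isEntireSeq_frobCoeff (a := a) hb (h := 0) (by simp) 1 x).congr fun k => ?_
  rw [frobCoeff_zero_one a hb]
  ring

/-- The Kummer function is bounded below by `1` for nonnegative arguments. -/
theorem one_le_kummerM {a b x : ℝ} (ha : 0 ≤ a) (hb : 0 < b) (hx : 0 ≤ x) :
    1 ≤ kummerM a b x := by
  have h := (summable_kummerM a x hb).le_tsum 0 fun j _ => by
    have h1 : 0 ≤ (ascPochhammer ℝ j).eval a := by
      rcases ha.eq_or_lt with rfl | ha
      · rw [ascPochhammer_eval_zero]; split_ifs <;> simp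
      · exact (ascPochhammer_pos j a ha).le
    have h2 := ascPochhammer_pos j b hb
    positivity
  simpa [kummerM] using h

/-- The Kummer function for a complex first parameter. -/
def kummerC (b x : ℝ) (a : ℂ) : ℂ :=
  ∑' k : ℕ, (ascPochhammer ℂ k).eval a *
    ((1 / (ascPochhammer ℝ k).eval b * (x ^ k / (k.factorial : ℝ)) : ℝ) : ℂ)

theorem kummerC_ofReal (a b x : ℝ) : kummerC b x a = kummerM a b x := by
  rw [kummerC, kummerM, Complex.ofReal_tsum]
  refine tsum_congr fun k => ?_
  have : (ascPochhammer ℂ k).eval (a : ℂ) = ((ascPochhammer ℝ k).eval a : ℝ) := by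
    have := (Polynomial.eval_map_apply (f := Complex.ofRealHom) (p := ascPochhammer ℝ k) (x := a))
    rwa [ascPochhammer_map] at this
  rw [this]
  push_cast
  ring

theorem norm_ascPochhammer_eval_le {a : ℂ} {R : ℝ} (h : ‖a‖ ≤ R) (k : ℕ) :
    ‖(ascPochhammer ℂ k).eval a‖ ≤ (ascPochhammer ℝ k).eval R := by
  induction k with
  | zero => simp
  | succ k ih =>
    rw [ascPochhammer_succ_eval, ascPochhammer_succ_eval, norm_mul]
    refine mul_le_mul ih ?_ (norm_nonneg _) ((norm_nonneg _).trans ih)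
    refine (norm_add_le _ _).trans ?_
    simpa using h

theorem differentiable_kummerC {b : ℝ} (hb : 0 < b) (x : ℝ) : Differentiable ℂ (kummerC b x) := by
  intro a
  set R := ‖a‖ + 1
  have h := Complex.differentiableOn_tsum_of_summable_norm (U := Metric.ball (0 : ℂ) R)
    (F := fun (k : ℕ) (a : ℂ) => (ascPochhammer ℂ k).eval a *
      ((1 / (ascPochhammer ℝ k).eval b * (x ^ k / (k.factorial : ℝ)) : ℝ) : ℂ))
    (summable_kummerM R |x| hb) (fun k => by fun_prop) Metric.isOpen_ball (fun k w hw => by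
      rw [norm_mul, Complex.norm_real, Real.norm_eq_abs, abs_mul, abs_div, abs_div, abs_pow,
        abs_of_pos (ascPochhammer_pos k b hb), abs_one, Nat.abs_cast]
      rw [mem_ball_zero_iff] at hw
      have h1 := norm_ascPochhammer_eval_le hw.le k
      have h2 := ascPochhammer_pos k b hb
      calc _ ≤ (ascPochhammer ℝ k).eval R *
            (1 / (ascPochhammer ℝ k).eval b * (|x| ^ k / (k.factorial : ℝ))) :=
            mul_le_mul_of_nonneg_right h1 (by positivity)
        _ = _ := by ring)
  exact (h a (by simp [R])).differentiableAt (Metric.isOpen_ball.mem_nhds (by simp [R]))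

theorem continuous_kummerM_param {b : ℝ} (hb : 0 < b) (x : ℝ) :
    Continuous fun a => kummerM a b x := by
  have h : (fun a => kummerM a b x) = fun a : ℝ => (kummerC b x a).re := by
    funext a
    rw [kummerC_ofReal, Complex.ofReal_re]
  rw [h]
  exact Complex.continuous_re.comp
    ((differentiable_kummerC hb x).continuous.comp Complex.continuous_ofReal)

/-- Infinitely many zeros in a compact interval would accumulate, and the identity theorem for the
entire extension `kummerC` would make it vanish identically, against `M(0, b, x) ≥ 1`. -/
theorem finite_kummerM_zeros_Icc {b x : ℝ} (hb : 0 < b) (hx : 0 ≤ x) (c d : ℝ) :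
    {a : ℝ | a ∈ Set.Icc c d ∧ kummerM a b x = 0}.Finite := by
  by_contra hinf
  obtain ⟨z, -, hz⟩ := Set.Infinite.exists_accPt_of_subset_isCompact (K := Set.Icc c d)
    hinf isCompact_Icc fun a ha => ha.1
  have hA : AnalyticOnNhd ℂ (kummerC b x) Set.univ :=
    (differentiable_kummerC hb x).differentiableOn.analyticOnNhd isOpen_univ
  have hfr : ∃ᶠ w in 𝓝[≠] (z : ℂ), kummerC b x w = 0 := by
    rw [accPt_iff_frequently_nhdsNE] at hz
    have ht : Tendsto (fun a : ℝ => (a : ℂ)) (𝓝[≠] z) (𝓝[≠] (z : ℂ)) := by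
      refine tendsto_nhdsWithin_of_tendsto_nhds_of_eventually_within _
        (Complex.continuous_ofReal.continuousAt.tendsto.mono_left nhdsWithin_le_nhds) ?_
      filter_upwards [self_mem_nhdsWithin] with a ha
      simpa using ha
    refine ht.frequently (hz.mono fun a ha => ?_)
    rw [kummerC_ofReal, ha.2, Complex.ofReal_zero]
  have h0 := hA.eqOn_zero_of_preconnected_of_frequently_eq_zero isPreconnected_univ
    (Set.mem_univ _) hfr (Set.mem_univ ((0 : ℝ) : ℂ))
  rw [kummerC_ofReal, Pi.zero_apply] at h0
  have := one_le_kummerM le_rfl hb hx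
  have h1 : kummerM 0 b x = 0 := by exact_mod_cast h0
  linarith
/-- A three-term recurrence of Laguerre type has no eventually positive solution. -/
theorem not_eventually_pos_of_recurrence {y : ℕ → ℝ} {b x : ℝ} (hb : 1 ≤ b) (hx : 0 < x)
    (h : ∀ k : ℕ, (b + k + 1) * (y (k + 1) - y (k + 2)) = (k + 1) * (y k - y (k + 1)) +
      x * y (k + 1)) (K : ℕ) (hpos : ∀ k ≥ K, 0 < y k) : False := by
  -- Write `d k = y k - y (k + 1)`. If no `d k` were positive, `y` would stay above `y K`, and `(b +
  -- k) d k` would grow by at least `x * y K` at each step, hence become positive. The hypothesis `1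
  -- ≤ b` enters here.
  obtain ⟨K₁, hK₁, hd₁⟩ : ∃ k ≥ K, 0 < y k - y (k + 1) := by
    by_contra! hcon
    have hmono : ∀ k ≥ K, y K ≤ y k := fun k hk => by
      induction k, hk using Nat.le_induction with
      | base => rfl
      | succ k hk ih => linarith [hcon k hk]
    have hlin : ∀ k ≥ K, (b + K) * (y K - y (K + 1)) + (k - K) * (x * y K) ≤
        (b + k) * (y k - y (k + 1)) := fun k hk => by
      induction k, hk using Nat.le_induction with
      | base => simp
      | succ k hk ih =>
        have h1 := hcon k hk
        have h2 := mul_le_mul_of_nonneg_left (hmono (k + 1) (by omega)) hx.le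
        have h3 : (b - 1) * (y k - y (k + 1)) ≤ 0 :=
          mul_nonpos_of_nonneg_of_nonpos (by linarith) h1
        push_cast
        rw [show b + ((k : ℝ) + 1) = b + k + 1 by ring, h k]
        linarith
    have hxy : 0 < x * y K := mul_pos hx (hpos K le_rfl)
    obtain ⟨i, hi⟩ := exists_nat_gt (-((b + K) * (y K - y (K + 1))) / (x * y K))
    rw [div_lt_iff₀ hxy] at hi
    have h1 := hlin (K + i) (by omega)
    have h2 : (b + (K + i : ℕ)) * (y (K + i) - y (K + i + 1)) ≤ 0 :=
      mul_nonpos_of_nonneg_of_nonpos (by positivity) (hcon (K + i) (by omega))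
    push_cast at h1 h2
    linarith
  have hy : ∀ k ≥ K₁, 0 < y k := fun k hk => hpos _ (by omega)
  have hd : ∀ k ≥ K₁, 0 < y k - y (k + 1) := fun k hk => by
    induction k, hk using Nat.le_induction with
    | base => exact hd₁
    | succ k hk ih =>
      have h1 := hy (k + 1) (by omega)
      refine pos_of_mul_pos_right (a := b + k + 1) ?_ (by positivity)
      rw [h k]
      positivity
  have hy₁ := hy K₁ le_rfl
  -- The first bound starts the induction for `c * y k ≤ d k`; the second, `b * c ≤ x`, lets the
  -- term `x * y (k + 1)` pay for the excess `b` of `b + k + 1` over `k + 1`.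
  set c := min ((y K₁ - y (K₁ + 1)) / y K₁) (x / b) with hc
  have hb0 : 0 < b := by linarith
  have hc0 : 0 < c := lt_min (div_pos hd₁ hy₁) (div_pos hx hb0)
  have hcx : b * c ≤ x := by
    have := min_le_right ((y K₁ - y (K₁ + 1)) / y K₁) (x / b)
    rw [← hc, le_div_iff₀ hb0] at this
    linarith
  have hcd : ∀ k ≥ K₁, c * y k ≤ y k - y (k + 1) := fun k hk => by
    induction k, hk using Nat.le_induction with
    | base => exact (le_div_iff₀ hy₁).1 (min_le_left _ _)
    | succ k hk ih =>
      have h1 := hy (k + 1) (by omega)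
      have h2 := hd k hk
      refine le_of_mul_le_mul_left ?_ (show 0 < b + k + 1 by positivity)
      rw [h k]
      have h3 : c * y (k + 1) ≤ c * y k := by nlinarith
      have h4 : ((k : ℝ) + 1) * (c * y (k + 1)) ≤ (k + 1) * (y k - y (k + 1)) :=
        mul_le_mul_of_nonneg_left (h3.trans ih) (by positivity)
      have h5 := mul_le_mul_of_nonneg_right hcx h1.le
      linarith
  -- For `k ≥ N` the loss factor `(k + 1)/(b + k + 1)` is at least `1 - c²`, while `y` shrinks by `1
  -- - c`. So `d k / y k` grows by `(1 - c²)/(1 - c) = 1 + c` per step, although it must stay below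
  -- `1`.
  obtain ⟨N, hN⟩ := exists_nat_ge (b / c ^ 2)
  rw [div_le_iff₀ (by positivity)] at hN
  have hc1 : 0 < 1 - c := by
    have h1 := hcd K₁ le_rfl
    exact pos_of_mul_pos_left (b := y K₁) (by linarith [hy (K₁ + 1) (by omega)]) hy₁.le
  have hgrow : ∀ i, c * (1 + c) ^ i * y (K₁ + N + i) ≤ y (K₁ + N + i) - y (K₁ + N + i + 1) := by
    intro i
    induction i with
    | zero => simpa using hcd (K₁ + N) (by omega)
    | succ i ih =>
      rw [← add_assoc (K₁ + N)]
      have hkN : (N : ℝ) ≤ (K₁ + N + i : ℕ) := by exact_mod_cast (by omega)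
      have hk : K₁ + N + i ≥ K₁ := by omega
      generalize K₁ + N + i = k at *
      have h1 := hy (k + 1) (by omega)
      have h2 := hd k hk
      have h3 := hcd k hk
      have hk1 : (b + k + 1) * (1 - c ^ 2) ≤ k + 1 := by nlinarith [sq_nonneg c]
      have h7 : (1 - c ^ 2) * (y k - y (k + 1)) ≤ y (k + 1) - y (k + 2) := by
        refine le_of_mul_le_mul_left ?_ (show 0 < b + k + 1 by positivity)
        rw [h k]
        have := mul_le_mul_of_nonneg_right hk1 h2.le
        have : 0 ≤ x * y (k + 1) := by positivity
        linarith
      have h8 : y (k + 1) ≤ (1 - c) * y k := by linarith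
      calc c * (1 + c) ^ (i + 1) * y (k + 1) ≤ c * (1 + c) ^ (i + 1) * ((1 - c) * y k) := by gcongr
        _ = (1 - c ^ 2) * (c * (1 + c) ^ i * y k) := by ring
        _ ≤ (1 - c ^ 2) * (y k - y (k + 1)) := by
          have : 0 ≤ 1 - c ^ 2 := by nlinarith
          gcongr
        _ ≤ _ := h7
  obtain ⟨i, hi⟩ := pow_unbounded_of_one_lt (1 / c) (show 1 < 1 + c by linarith)
  have h1 := hgrow i
  have h2 := hy (K₁ + N + i) (by omega)
  have h3 := hy (K₁ + N + i + 1) (by omega)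
  rw [div_lt_iff₀ hc0] at hi
  nlinarith

/-- This is `a (a + 1)_j = (a + j) (a)_j`, the coefficient form of a shift in the first parameter.
-/
theorem frobCoeff_contiguous (a : ℝ) {b : ℝ} (hb : 0 < b) (j : ℕ) :
    a * frobCoeff (a + 1) b 0 1 j = (a + j) * frobCoeff a b 0 1 j := by
  induction j with
  | zero => simp [frobCoeff]
  | succ j ih =>
    have h2 : b + j ≠ 0 := by positivity
    simp only [frobCoeff, Pi.zero_apply, add_zero]
    push_cast
    field_simp
    linear_combination (a + 1 + j) * ih

/-- The contiguous relation between `M(a - 1, b, x)`, `M(a, b, x)` and `M(a + 1, b, x)`. -/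
theorem kummerM_contiguous (a x : ℝ) {b : ℝ} (hb : 0 < b) :
    (b - a) * kummerM (a - 1) b x + (2 * a - b + x) * kummerM a b x
      - a * kummerM (a + 1) b x = 0 := by
  simp only [kummerM_eq_powSum _ x hb]
  have hE : ∀ a, HasSum (fun j => frobCoeff a b 0 1 j * x ^ j) (powSum (frobCoeff a b 0 1) x) :=
    fun a => (isEntireSeq_frobCoeff hb (by simp) 1).hasSum x
  have h1 := (((hE (a - 1)).mul_left (b - a)).add ((hE a).mul_left (2 * a - b))).sub
    ((hE (a + 1)).mul_left a)
  -- The factor `x` raises degrees by one, so coefficient `j + 1` of the other terms is compared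
  -- with coefficient `j` of `x M(a, b, x)`; the constant term is split off and vanishes separately.
  have h2 := (hasSum_nat_add_iff' 1).2 h1
  rw [Finset.sum_range_one] at h2
  have h3 := h2.add ((hE a).mul_left x)
  have h5 : ∀ j : ℕ, (b - a) * (frobCoeff (a - 1) b 0 1 (j + 1) * x ^ (j + 1)) +
      (2 * a - b) * (frobCoeff a b 0 1 (j + 1) * x ^ (j + 1)) -
      a * (frobCoeff (a + 1) b 0 1 (j + 1) * x ^ (j + 1)) +
      x * (frobCoeff a b 0 1 j * x ^ j) = 0 := by
    intro j
    have h2 : b + j ≠ 0 := by positivity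
    have e1 := frobCoeff_contiguous a hb (j + 1)
    have e2 := frobCoeff_contiguous (a - 1) hb j
    rw [sub_add_cancel] at e2
    have e3 : (b - a) * frobCoeff (a - 1) b 0 1 (j + 1) + (2 * a - b) * frobCoeff a b 0 1 (j + 1)
        - (a + (j + 1)) * frobCoeff a b 0 1 (j + 1) + frobCoeff a b 0 1 j = 0 := by
      simp only [frobCoeff, Pi.zero_apply, add_zero]
      field_simp
      linear_combination (a - b) * e2
    push_cast at e1
    linear_combination x ^ (j + 1) * e3 - x ^ (j + 1) * e1
  have h6 := h3.tsum_eq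
  rw [tsum_congr h5, tsum_zero] at h6
  simp only [frobCoeff] at h6
  linear_combination -h6

/-- The zeros of the Kummer function in its first parameter are unbounded below. -/
theorem exists_kummerM_zero_lt {b x : ℝ} (hb : 1 ≤ b) (hx : 0 < x) (c : ℝ) :
    ∃ a < c, kummerM a b x = 0 := by
  have hb0 : 0 < b := by linarith
  by_contra! hcon
  have hrec : ∀ k : ℕ, (b + k + 1) * (kummerM (-((k + 1 : ℕ) : ℝ)) b x -
      kummerM (-((k + 2 : ℕ) : ℝ)) b x) = (k + 1) * (kummerM (-(k : ℝ)) b x -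
      kummerM (-((k + 1 : ℕ) : ℝ)) b x) + x * kummerM (-((k + 1 : ℕ) : ℝ)) b x := by
    intro k
    have e := kummerM_contiguous (-((k + 1 : ℕ) : ℝ)) x hb0
    rw [show -((k + 1 : ℕ) : ℝ) - 1 = -((k + 2 : ℕ) : ℝ) by push_cast; ring,
      show -((k + 1 : ℕ) : ℝ) + 1 = -(k : ℝ) by push_cast; ring] at e
    push_cast at e ⊢
    linear_combination -e
  obtain ⟨K, hK⟩ := exists_nat_gt (-c)
  have hK' : ∀ k ≥ K, -(k : ℝ) < c := fun k hk => by
    have : (K : ℝ) ≤ k := by exact_mod_cast hk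
    linarith
  have hcont := continuous_kummerM_param hb0 x
  have hsign : ∀ k ≥ K, 0 < kummerM (-(K : ℝ)) b x * kummerM (-(k : ℝ)) b x := by
    intro k hk
    by_contra! hneg
    have h0 : (0 : ℝ) ∈ (fun a => kummerM a b x) '' Set.uIcc (-(K : ℝ)) (-(k : ℝ)) := by
      refine intermediate_value_uIcc hcont.continuousOn ?_
      rw [Set.mem_uIcc]
      rcases le_or_gt 0 (kummerM (-(K : ℝ)) b x) with h | h
      · rcases h.eq_or_lt with h | h
        · exact absurd h.symm (hcon _ (hK' K le_rfl))
        · exact Or.inr ⟨nonpos_of_mul_nonpos_right hneg h, h.le⟩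
      · exact Or.inl ⟨h.le, nonneg_of_mul_nonpos_right hneg h⟩
    obtain ⟨a, ha, ha0⟩ := h0
    have hKk : (K : ℝ) ≤ k := by exact_mod_cast hk
    rw [Set.uIcc_of_ge (by linarith)] at ha
    exact hcon a (ha.2.trans_lt (hK' K le_rfl)) ha0
  -- Multiplication by the fixed value at `-K` turns constant sign into positivity and preserves the
  -- linear recurrence.
  refine not_eventually_pos_of_recurrence (y := fun k => kummerM (-(K : ℝ)) b x *
    kummerM (-(k : ℝ)) b x) hb hx (fun k => ?_) K hsign
  linear_combination kummerM (-(K : ℝ)) b x * hrec k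

/-- The Kummer function tends to `1` as the second parameter tends to infinity. -/
theorem tendsto_kummerM_nat (a x : ℝ) :
    Tendsto (fun n : ℕ => kummerM a (n + 1) x) atTop (𝓝 1) := by
  have hlow : ∀ n j : ℕ, (ascPochhammer ℝ j).eval 1 ≤ (ascPochhammer ℝ j).eval ((n : ℝ) + 1) := by
    intro n j
    induction j with
    | zero => simp
    | succ j ih =>
      rw [ascPochhammer_succ_eval, ascPochhammer_succ_eval]
      have := (ascPochhammer_pos j (1 : ℝ) one_pos).le
      have h2 : (1 : ℝ) + j ≤ n + 1 + j := by linarith [(Nat.cast_nonneg n : (0 : ℝ) ≤ n)]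
      exact mul_le_mul ih h2 (by positivity) (this.trans ih)
  have hlow2 : ∀ n j : ℕ, (n : ℝ) ≤ (ascPochhammer ℝ (j + 1)).eval ((n : ℝ) + 1) := by
    intro n j
    rw [ascPochhammer_succ_eval]
    have h1 : 1 ≤ (ascPochhammer ℝ j).eval ((n : ℝ) + 1) := by
      refine le_trans ?_ (hlow n j)
      rw [ascPochhammer_eval_one]
      exact_mod_cast Nat.factorial_pos j
    have h2 : (0 : ℝ) ≤ j := by positivity
    have h3 : (0 : ℝ) ≤ n := by positivity
    nlinarith
  -- The series at second parameter `1` is a majorant for all `n`; each term of positive degree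
  -- tends to `0` because `(n + 1)_{j+1} ≥ n`.
  have key := tendsto_tsum_of_dominated_convergence (𝓕 := atTop)
    (f := fun (n j : ℕ) => (ascPochhammer ℝ j).eval a / (ascPochhammer ℝ j).eval ((n : ℝ) + 1) *
      (x ^ j / (j.factorial : ℝ))) (g := fun j : ℕ => if j = 0 then (1 : ℝ) else 0)
    (summable_kummerM a x one_pos).norm (fun j => ?_) (Eventually.of_forall fun n j => ?_)
  · rwa [tsum_ite_eq] at key
  · cases j with
    | zero => simp
    | succ j =>
      simp only [Nat.add_eq_zero_iff, one_ne_zero, and_false, if_false]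
      have h : Tendsto (fun n : ℕ => (ascPochhammer ℝ (j + 1)).eval ((n : ℝ) + 1)) atTop atTop :=
        tendsto_atTop_mono (fun n => hlow2 n j) tendsto_natCast_atTop_atTop
      simpa using (h.const_div_atTop ((ascPochhammer ℝ (j + 1)).eval a)).mul_const
        (x ^ (j + 1) / ((j + 1).factorial : ℝ))
  · have h1 := ascPochhammer_pos j (1 : ℝ) one_pos
    have h2 := ascPochhammer_pos j ((n : ℝ) + 1) (by positivity)
    rw [norm_mul, norm_mul]
    refine mul_le_mul_of_nonneg_right ?_ (norm_nonneg _)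
    rw [norm_div, norm_div, Real.norm_of_nonneg h1.le, Real.norm_of_nonneg h2.le]
    gcongr
    exact hlow n j

/-! ### Enumeration of the zeros in decreasing order -/

theorem kummerM_zero_neg (n : ℕ) (α : ℝ) {a : ℝ} (h : kummerM a (n + 1) (α ^ 2) = 0) : a < 0 := by
  by_contra! ha
  linarith [one_le_kummerM ha (by positivity : (0 : ℝ) < n + 1) (sq_nonneg α)]

/-- The supremum of the zeros below `c` is a zero. -/
theorem sSup_kummerM_zeros_mem (n : ℕ) {α : ℝ} (hα : α ≠ 0) (c : ℝ) :
    IsGreatest {a : ℝ | a < c ∧ kummerM a (n + 1) (α ^ 2) = 0}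
      (sSup {a : ℝ | a < c ∧ kummerM a (n + 1) (α ^ 2) = 0}) := by
  have hb : (1 : ℝ) ≤ n + 1 := by linarith [(Nat.cast_nonneg n : (0 : ℝ) ≤ n)]
  obtain ⟨a₀, h1, h2⟩ := exists_kummerM_zero_lt hb (by positivity : 0 < α ^ 2) c
  have hfin := (finite_kummerM_zeros_Icc (b := (n : ℝ) + 1) (by positivity)
    (sq_nonneg α) a₀ c).subset (show {a | a₀ ≤ a ∧ a < c ∧ kummerM a (n + 1) (α ^ 2) = 0} ⊆ _ from
    fun a ha => ⟨⟨ha.1, ha.2.1.le⟩, ha.2.2⟩)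
  -- The supremum is attained: starting from some zero `a₀ < c`, only finitely many zeros lie in
  -- `[a₀, c)`.
  obtain ⟨m, hm, hmax⟩ := Set.exists_max_image _ id hfin ⟨a₀, le_rfl, h1, h2⟩
  have hg : IsGreatest {a : ℝ | a < c ∧ kummerM a (n + 1) (α ^ 2) = 0} m := by
    refine ⟨hm.2, fun a ha => ?_⟩
    rcases le_total a₀ a with h | h
    · exact hmax a ⟨h, ha⟩
    · exact h.trans hm.1
  rwa [hg.csSup_eq]

theorem kummerZero_isGreatest_zero (n : ℕ) {α : ℝ} (hα : α ≠ 0) :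
    IsGreatest {a : ℝ | kummerM a (n + 1) (α ^ 2) = 0} (kummerZero n α 0) := by
  have h := sSup_kummerM_zeros_mem n hα 0
  have e : {a : ℝ | a < 0 ∧ kummerM a (n + 1) (α ^ 2) = 0} =
      {a : ℝ | kummerM a (n + 1) (α ^ 2) = 0} :=
    Set.ext fun a => ⟨fun h => h.2, fun h => ⟨kummerM_zero_neg n α h, h⟩⟩
  rwa [e] at h

theorem kummerM_kummerZero (n : ℕ) {α : ℝ} (hα : α ≠ 0) (k : ℕ) :
    kummerM (kummerZero n α k) (n + 1) (α ^ 2) = 0 := by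
  cases k with
  | zero => exact (kummerZero_isGreatest_zero n hα).1
  | succ k => exact (sSup_kummerM_zeros_mem n hα (kummerZero n α k)).1.2

theorem strictAnti_kummerZero (n : ℕ) {α : ℝ} (hα : α ≠ 0) : StrictAnti (kummerZero n α) :=
  strictAnti_nat_of_succ_lt fun k => (sSup_kummerM_zeros_mem n hα (kummerZero n α k)).1.1

/-- A zero missed by the enumeration would lie below all its terms, which would then be infinitely
many zeros in a compact interval. -/
theorem range_kummerZero (n : ℕ) {α : ℝ} (hα : α ≠ 0) :
    Set.range (kummerZero n α) = {a : ℝ | kummerM a (n + 1) (α ^ 2) = 0} := by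
  refine Set.Subset.antisymm (Set.range_subset_iff.2 (kummerM_kummerZero n hα)) fun a ha => ?_
  by_contra hcon
  have hlt : ∀ k, a < kummerZero n α k := by
    intro k
    induction k with
    | zero =>
      exact lt_of_le_of_ne ((kummerZero_isGreatest_zero n hα).2 ha) fun h => hcon ⟨0, h.symm⟩
    | succ k ih =>
      exact lt_of_le_of_ne ((sSup_kummerM_zeros_mem n hα (kummerZero n α k)).2 ⟨ih, ha⟩)
        fun h => hcon ⟨k + 1, h.symm⟩
  have hfin := finite_kummerM_zeros_Icc (b := (n : ℝ) + 1) (by positivity) (sq_nonneg α) a 0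
  refine Set.infinite_range_of_injective (strictAnti_kummerZero n hα).injective (hfin.subset ?_)
  rintro _ ⟨k, rfl⟩
  have h0 := kummerM_kummerZero n hα k
  exact ⟨⟨(hlt k).le, (kummerM_zero_neg n α h0).le⟩, h0⟩

/-! ### Membership in the Sobolev space `H¹₀` -/

theorem L2_norm_sq_eq_integral {X : Type*} [MeasurableSpace X] {μ : Measure X} (u : Lp ℂ 2 μ) :
    ‖u‖ ^ 2 = ∫ x, ‖u x‖ ^ 2 ∂μ := by
  have h := L2.inner_def (𝕜 := ℂ) u u
  rw [inner_self_eq_norm_sq_to_K] at h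
  have h2 : ∀ x, inner ℂ (u x) (u x) = ((‖u x‖ ^ 2 : ℝ) : ℂ) := fun x => by
    rw [inner_self_eq_norm_sq_to_K]
    norm_cast
  simp only [h2] at h
  rw [integral_complex_ofReal] at h
  refine Complex.ofReal_injective (Eq.trans ?_ h)
  norm_cast

/-- Bounded pointwise convergence on a finite measure space implies convergence in `L²`. -/
theorem tendsto_L2_of_dominated {X : Type*} [MeasurableSpace X] {μ : Measure X} [IsFiniteMeasure μ]
    {v : ℕ → Lp ℂ 2 μ} {u : Lp ℂ 2 μ} {G : ℕ → X → ℂ} {F : X → ℂ} (hv : ∀ n, v n =ᵐ[μ] G n)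
    (hu : u =ᵐ[μ] F) (C : ℝ) (hC : ∀ n, ∀ᵐ x ∂μ, ‖G n x‖ ≤ C)
    (hlim : ∀ᵐ x ∂μ, Tendsto (fun n => G n x) atTop (𝓝 (F x))) :
    Tendsto v atTop (𝓝 u) := by
  rw [tendsto_iff_norm_sub_tendsto_zero]
  have key : Tendsto (fun n => ∫ x, ‖(v n - u) x‖ ^ 2 ∂μ) atTop (𝓝 (∫ x, (0 : ℝ) ∂μ)) := by
    have hbd : ∀ᵐ x ∂μ, ∀ n, ‖G n x‖ ≤ C := ae_all_iff.2 hC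
    have hva : ∀ᵐ x ∂μ, ∀ n, (v n - u) x = G n x - F x := ae_all_iff.2 fun n => by
      filter_upwards [Lp.coeFn_sub (v n) u, hv n, hu] with x h1 h2 h3
      rw [h1, Pi.sub_apply, h2, h3]
    refine tendsto_integral_of_dominated_convergence (fun _ => (2 * C) ^ 2)
      (fun n => ((Lp.aestronglyMeasurable (v n - u)).norm.pow 2)) (integrable_const _)
      (fun n => ?_) ?_
    · filter_upwards [hbd, hva, hlim] with x h1 h2 h3
      have h4 : ‖F x‖ ≤ C := le_of_tendsto h3.norm (Eventually.of_forall h1)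
      rw [h2 n, Real.norm_of_nonneg (by positivity)]
      refine pow_le_pow_left₀ (norm_nonneg _) ?_ 2
      linarith [norm_sub_le (G n x) (F x), h1 n]
    · filter_upwards [hva, hlim] with x h2 h3
      simp only [h2]
      have h4 := (h3.sub_const (F x)).norm.pow 2
      simpa using h4
  simp only [← L2_norm_sq_eq_integral, integral_zero] at key
  simpa using key.sqrt

instance isFiniteMeasure_restrict_ball (c : Plane) (r : ℝ) :
    IsFiniteMeasure (volume.restrict (Metric.ball c r)) :=
  ⟨by rw [Measure.restrict_apply_univ]; exact measure_ball_lt_top⟩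

theorem continuous_partialDeriv {f : Plane → ℂ} (hf : ContDiff ℝ 1 f) (j : Fin 2) :
    Continuous (partialDeriv j f) :=
  (hf.continuous_fderiv (by simp)).clm_apply continuous_const

theorem hasCompactSupport_partialDeriv {f : Plane → ℂ} (hf : HasCompactSupport f) (j : Fin 2) :
    HasCompactSupport (partialDeriv j f) :=
  (hf.fderiv (𝕜 := ℝ)).comp_left
    (g := fun L : Plane →L[ℝ] ℂ => L (EuclideanSpace.single j 1)) (by simp)

/-- `C¹` functions with compact support in `Ω` belong to `H¹₀(Ω)`. -/
theorem mem_sobolevGraph_of_contDiff_one {Ω : Set Plane} (hΩ : IsOpen Ω)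
    [IsFiniteMeasure (volume.restrict Ω)] {f : Plane → ℂ} (hf : ContDiff ℝ 1 f)
    (cf : HasCompactSupport f) (sf : tsupport f ⊆ Ω) {p : L2 Ω × (Fin 2 → L2 Ω)}
    (hp : p.1 =ᵐ[volume.restrict Ω] f) (hp' : ∀ j, p.2 j =ᵐ[volume.restrict Ω] partialDeriv j f) :
    p ∈ sobolevGraph Ω := by
  -- The margin `δ` between the support and the complement of `Ω` leaves room for mollifiers of
  -- radius `δ / (n + 1)`.
  obtain ⟨δ, hδ, hδΩ⟩ := IsCompact.exists_cthickening_subset_open cf.isCompact hΩ sf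
  let φ : ℕ → ContDiffBump (0 : Plane) := fun n =>
    ⟨δ / (n + 1) / 2, δ / (n + 1), by positivity, half_lt_self (by positivity)⟩
  have hφ0 : Tendsto (fun n => (φ n).rOut) atTop (𝓝 0) := by
    have := (tendsto_one_div_add_atTop_nhds_zero_nat (𝕜 := ℝ)).const_mul δ
    simpa [φ, div_eq_mul_inv] using this
  have hφδ : ∀ n, (φ n).rOut ≤ δ := fun n => by
    have : (1 : ℝ) ≤ n + 1 := by linarith [(Nat.cast_nonneg n : (0 : ℝ) ≤ n)]
    exact div_le_self hδ.le this
  let con : ℕ → (Plane → ℂ) → Plane → ℂ := fun n g =>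
    convolution ((φ n).normed volume) g (ContinuousLinearMap.lsmul ℝ ℝ) volume
  have hcon_lim : ∀ g : Plane → ℂ, Continuous g → ∀ x,
      Tendsto (fun n => con n g x) atTop (𝓝 (g x)) := fun g hg x =>
    ContDiffBump.convolution_tendsto_right_of_continuous hφ0 hg x
  have hcon_bd : ∀ g : Plane → ℂ, Continuous g → HasCompactSupport g →
      ∃ C, ∀ n x, ‖con n g x‖ ≤ C := by
    intro g hg cg
    obtain ⟨C, hC⟩ := hg.bounded_above_of_compact_support cg
    refine ⟨C + (C + C), fun n x => ?_⟩
    have h1 : dist (con n g x) (g x) ≤ C + C :=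
      ContDiffBump.dist_normed_convolution_le hg.aestronglyMeasurable fun y _ => by
        rw [dist_eq_norm]
        exact (norm_sub_le _ _).trans (add_le_add (hC y) (hC x))
    rw [dist_eq_norm] at h1
    have h2 := norm_add_le (g x) (con n g x - g x)
    rw [add_sub_cancel] at h2
    linarith [hC x]
  have smooth : ∀ n, ContDiff ℝ ∞ (con n f) := fun n =>
    (φ n).hasCompactSupport_normed.contDiff_convolution_left _ (φ n).contDiff_normed
      (hf.continuous.locallyIntegrable)
  have cs : ∀ n, HasCompactSupport (con n f) := fun n =>
    HasCompactSupport.convolution _ (φ n).hasCompactSupport_normed cf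
  have ts : ∀ n, tsupport (con n f) ⊆ Ω := by
    intro n
    refine Set.Subset.trans (closure_minimal ?_ Metric.isClosed_cthickening) hδΩ
    refine (support_convolution_subset _).trans ?_
    rw [ContDiffBump.support_normed_eq]
    rintro _ ⟨y, hy, z, hz, rfl⟩
    refine Metric.mem_cthickening_of_dist_le _ z _ _ (subset_tsupport f hz) ?_
    rw [dist_eq_norm, add_sub_cancel_right]
    rw [mem_ball_zero_iff] at hy
    exact hy.le.trans (hφδ n)
  -- The derivative falls on `f`, so the gradients of the mollifications are mollifications of the
  -- continuous gradient.
  have pd : ∀ n j x, partialDeriv j (con n f) x = con n (partialDeriv j f) x := by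
    intro n j x
    have hli : LocallyIntegrable ((φ n).normed volume) volume :=
      (φ n).contDiff_normed (n := 1) |>.continuous.locallyIntegrable
    have h1 := cf.hasFDerivAt_convolution_right (ContinuousLinearMap.lsmul ℝ ℝ) hli hf x
    rw [partialDeriv, h1.fderiv]
    exact convolution_precompR_apply _ hli (cf.fderiv (𝕜 := ℝ)) (hf.continuous_fderiv (by simp)) x _
  have mf : ∀ n, MemLp (con n f) 2 (volume.restrict Ω) := fun n =>
    (smooth n).continuous.memLp_of_hasCompactSupport (cs n)
  have md : ∀ n j, MemLp (partialDeriv j (con n f)) 2 (volume.restrict Ω) := fun n j =>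
    (continuous_partialDeriv ((smooth n).of_le (by simp)) j).memLp_of_hasCompactSupport
      (hasCompactSupport_partialDeriv (cs n) j)
  have hmem : ∀ n, ((mf n).toLp _, fun j => (md n j).toLp _) ∈ testGraph Ω := fun n =>
    ⟨con n f, smooth n, cs n, ts n, (mf n).coeFn_toLp, fun j => (md n j).coeFn_toLp⟩
  refine mem_closure_of_tendsto (b := atTop) (f := fun n => ((mf n).toLp _, fun j => (md n j).toLp _))
    ?_ (Eventually.of_forall hmem)
  refine Tendsto.prodMk_nhds ?_ (tendsto_pi_nhds.2 fun j => ?_)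
  · obtain ⟨C, hC⟩ := hcon_bd f hf.continuous cf
    exact tendsto_L2_of_dominated (fun n => (mf n).coeFn_toLp) hp C
      (fun n => Eventually.of_forall (hC n)) (Eventually.of_forall (hcon_lim f hf.continuous))
  · have hc := continuous_partialDeriv hf j
    obtain ⟨C, hC⟩ := hcon_bd _ hc (hasCompactSupport_partialDeriv cf j)
    refine tendsto_L2_of_dominated (fun n => (md n j).coeFn_toLp) (hp' j) C
      (fun n => Eventually.of_forall fun x => ?_) (Eventually.of_forall fun x => ?_)
    · rw [pd]
      exact hC n x
    · simp only [pd]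
      exact hcon_lim _ hc x

theorem deriv_smoothTransition_of_one_lt {t : ℝ} (ht : 1 < t) :
    deriv Real.smoothTransition t = 0 := by
  have : Real.smoothTransition =ᶠ[𝓝 t] fun _ => 1 := by
    filter_upwards [lt_mem_nhds ht] with s hs
    exact Real.smoothTransition.one_of_one_le hs.le
  rw [this.deriv_eq, deriv_const]

/-- There is a bound for `t S'(t)`, `S` the smooth transition function, on `-1 ≤ t`. -/
theorem exists_bound_deriv_smoothTransition :
    ∃ K : ℝ, 0 ≤ K ∧ ∀ t : ℝ, -1 ≤ t → (t + 1) * |deriv Real.smoothTransition t| ≤ K := by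
  have hc : Continuous fun t : ℝ => (t + 1) * |deriv Real.smoothTransition t| := by
    have := (Real.smoothTransition.contDiff (n := 1)).continuous_deriv (by simp)
    fun_prop
  obtain ⟨K, hK⟩ := isCompact_Icc.exists_bound_of_continuousOn (s := Set.Icc (-1 : ℝ) 1)
    hc.continuousOn
  have hK0 : 0 ≤ K := (norm_nonneg _).trans (hK 0 (by norm_num))
  refine ⟨K, hK0, fun t ht => ?_⟩
  rcases le_or_gt t 1 with h | h
  · exact (le_abs_self _).trans (hK t ⟨ht, h⟩)
  · rw [deriv_smoothTransition_of_one_lt h]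
    simpa using hK0

/-- `C¹` functions on a disc with bounded gradient that vanish linearly at the boundary belong to
`H¹₀`. -/
theorem mem_sobolevGraph_of_vanishing {r : ℝ} (hr : 0 < r) {v : Plane → ℂ}
    (hv : ContDiffOn ℝ 1 v (Metric.ball 0 r)) {C : ℝ}
    (hC : ∀ x ∈ Metric.ball (0 : Plane) r, ‖v x‖ ≤ C * (r ^ 2 - ‖x‖ ^ 2))
    (hC' : ∀ x ∈ Metric.ball (0 : Plane) r, ∀ j, ‖partialDeriv j v x‖ ≤ C)
    {p : L2 (Metric.ball (0 : Plane) r) × (Fin 2 → L2 (Metric.ball (0 : Plane) r))}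
    (hp : p.1 =ᵐ[volume.restrict (Metric.ball 0 r)] v)
    (hp' : ∀ j, p.2 j =ᵐ[volume.restrict (Metric.ball 0 r)] partialDeriv j v) :
    p ∈ sobolevGraph (Metric.ball 0 r) := by
  obtain ⟨K, hK0, hK⟩ := exists_bound_deriv_smoothTransition
  set S := Real.smoothTransition with hS
  have hC0 : 0 ≤ C := (norm_nonneg _).trans (hC' 0 (by simpa using hr) 0)
  -- The cutoff `S (t n x)` vanishes where `r² - |x|² ≤ 1/(n+1)` and equals `1` where it is at least
  -- `2/(n+1)`. Its gradient is of order `n` on a layer where `v` is of order `1/n`.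
  let t : ℕ → Plane → ℝ := fun n x => (n + 1) * (r ^ 2 - ‖x‖ ^ 2) - 1
  have ht : ∀ n, ContDiff ℝ 1 (t n) := fun n =>
    (contDiff_const.mul (contDiff_const.sub (contDiff_norm_sq ℝ))).sub contDiff_const
  have hχ : ∀ n, ContDiff ℝ 1 fun x => S (t n x) := fun n =>
    (Real.smoothTransition.contDiff (n := 1)).comp (ht n)
  let f : ℕ → Plane → ℂ := fun n x => S (t n x) • v x
  have f0 : ∀ n x, t n x ≤ 0 → f n x = 0 := fun n x h => by
    simp only [f, hS, Real.smoothTransition.zero_of_nonpos h, zero_smul]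
  have hsupp : ∀ n, tsupport (f n) ⊆ {x | 0 ≤ t n x} := fun n =>
    closure_minimal (fun x hx => by
      by_contra h
      exact hx (f0 n x (not_le.1 h).le)) (isClosed_le continuous_const (ht n).continuous)
  have hball : ∀ n x, 0 ≤ t n x → x ∈ Metric.ball (0 : Plane) r := fun n x h => by
    rw [mem_ball_zero_iff]
    refine lt_of_pow_lt_pow_left₀ 2 hr.le ?_
    have h1 : 0 < ((n : ℝ) + 1) * (r ^ 2 - ‖x‖ ^ 2) := by simp only [t] at h; linarith
    have := pos_of_mul_pos_right h1 (by positivity)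
    linarith
  have sub : ∀ n, tsupport (f n) ⊆ Metric.ball 0 r := fun n x hx => hball n x (hsupp n hx)
  have cf : ∀ n, HasCompactSupport (f n) := fun n =>
    Metric.isCompact_of_isClosed_isBounded (isClosed_tsupport _)
      (Metric.isBounded_ball.subset (sub n))
  have hfd : ∀ n, ContDiff ℝ 1 (f n) := fun n => by
    rw [contDiff_iff_contDiffAt]
    intro x
    by_cases hx : x ∈ Metric.ball (0 : Plane) r
    · exact (hχ n).contDiffAt.smul (hv.contDiffAt (Metric.isOpen_ball.mem_nhds hx))
    · have : f n =ᶠ[𝓝 x] fun _ => 0 :=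
        notMem_tsupport_iff_eventuallyEq.1 fun h => hx (sub n h)
      exact contDiffAt_const.congr_of_eventuallyEq this
  have hpd : ∀ n j, ∀ x ∈ Metric.ball (0 : Plane) r, partialDeriv j (f n) x =
      S (t n x) • partialDeriv j v x +
        (deriv S (t n x) * ((n + 1) * (-(2 * x j)))) • v x := by
    intro n j x hx
    have hvx := ((hv.contDiffAt (Metric.isOpen_ball.mem_nhds hx)).differentiableAt
      (by simp)).hasFDerivAt
    have hSx : HasDerivAt S (deriv S (t n x)) (t n x) :=
      ((Real.smoothTransition.contDiff (n := 1)).differentiable (by simp) _).hasDerivAt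
    have htx : HasFDerivAt (t n) (((n : ℝ) + 1) •
        (-(2 • innerSL ℝ x) : Plane →L[ℝ] ℝ)) x :=
      ((((hasStrictFDerivAt_norm_sq x).hasFDerivAt.const_sub _).const_mul _).sub_const _)
    have : HasFDerivAt (f n) _ x := (hSx.comp_hasFDerivAt x htx).smul hvx
    rw [partialDeriv, this.fderiv, partialDeriv]
    simp only [Function.comp_apply, add_apply, smul_apply,
      ContinuousLinearMap.smulRight_apply, neg_apply, innerSL_apply_apply,
      EuclideanSpace.inner_single_right, nsmul_eq_mul, smul_eq_mul]
    simp
  have mf : ∀ n, MemLp (f n) 2 (volume.restrict (Metric.ball 0 r)) := fun n =>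
    (hfd n).continuous.memLp_of_hasCompactSupport (cf n)
  have md : ∀ n j, MemLp (partialDeriv j (f n)) 2 (volume.restrict (Metric.ball 0 r)) := fun n j =>
    (continuous_partialDeriv (hfd n) j).memLp_of_hasCompactSupport
      (hasCompactSupport_partialDeriv (cf n) j)
  have hmem : ∀ n, ((mf n).toLp _, fun j => (md n j).toLp _) ∈ sobolevGraph (Metric.ball 0 r) :=
    fun n => mem_sobolevGraph_of_contDiff_one Metric.isOpen_ball (hfd n) (cf n) (sub n)
      (mf n).coeFn_toLp fun j => (md n j).coeFn_toLp
  have hS1 : ∀ s, |S s| ≤ 1 := fun s => by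
    rw [abs_of_nonneg (Real.smoothTransition.nonneg s)]
    exact Real.smoothTransition.le_one s
  have htlim : ∀ x ∈ Metric.ball (0 : Plane) r, Tendsto (fun n => t n x) atTop atTop := by
    intro x hx
    rw [mem_ball_zero_iff] at hx
    have h1 : 0 < r ^ 2 - ‖x‖ ^ 2 := by nlinarith [norm_nonneg x]
    exact tendsto_atTop_add_const_right _ _ (Tendsto.atTop_mul_const h1
      (tendsto_atTop_add_const_right _ _ tendsto_natCast_atTop_atTop))
  have hball_ae : ∀ᵐ x ∂(volume.restrict (Metric.ball (0 : Plane) r)),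
      x ∈ Metric.ball (0 : Plane) r :=
    ae_restrict_mem measurableSet_ball
  refine (Submodule.isClosed_topologicalClosure (testGraph _)).mem_of_tendsto (b := atTop)
    (f := fun n => ((mf n).toLp _, fun j => (md n j).toLp _)) ?_ (Eventually.of_forall hmem)
  refine Tendsto.prodMk_nhds ?_ (tendsto_pi_nhds.2 fun j => ?_)
  · refine tendsto_L2_of_dominated (fun n => (mf n).coeFn_toLp) hp (C * r ^ 2) (fun n => ?_) ?_
    · filter_upwards [hball_ae] with x hx
      rw [norm_smul, Real.norm_eq_abs]
      have h1 := hC x hx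
      have h2 : C * (r ^ 2 - ‖x‖ ^ 2) ≤ C * r ^ 2 := by gcongr; linarith [sq_nonneg ‖x‖]
      nlinarith [hS1 (t n x), norm_nonneg (v x), abs_nonneg (S (t n x))]
    · filter_upwards [hball_ae] with x hx
      refine tendsto_const_nhds.congr' ?_
      filter_upwards [(htlim x hx).eventually_gt_atTop 1] with n hn
      simp only [f, hS, Real.smoothTransition.one_of_one_le hn.le, one_smul]
  -- In the bound, `K * C` comes from `(n + 1)(r² - |x|²) = t + 1` and the bound on `(t + 1) S'(t)`.
  -- At each fixed point the gradient of the cutoff is eventually zero.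
  · refine tendsto_L2_of_dominated (fun n => (md n j).coeFn_toLp) (hp' j) (C + 2 * r * (K * C))
      (fun n => ?_) ?_
    · filter_upwards [hball_ae] with x hx
      rw [hpd n j x hx]
      refine (norm_add_le _ _).trans (add_le_add ?_ ?_)
      · rw [norm_smul, Real.norm_eq_abs]
        nlinarith [hS1 (t n x), hC' x hx j, norm_nonneg (partialDeriv j v x),
          abs_nonneg (S (t n x))]
      · have hxr : ‖x‖ < r := mem_ball_zero_iff.1 hx
        have h1 : 0 < r ^ 2 - ‖x‖ ^ 2 := by nlinarith [norm_nonneg x]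
        have h2 : -1 ≤ t n x := by
          have : 0 ≤ ((n : ℝ) + 1) * (r ^ 2 - ‖x‖ ^ 2) := by positivity
          simp only [t]
          linarith
        have h3 := hK (t n x) h2
        have h4 : |x j| ≤ r := (PiLp.norm_apply_le x j).trans hxr.le
        rw [norm_smul, norm_mul, norm_mul, Real.norm_eq_abs, Real.norm_eq_abs, Real.norm_eq_abs,
          abs_neg, abs_mul, abs_two, abs_of_pos (by positivity : (0 : ℝ) < n + 1)]
        calc _ ≤ |deriv S (t n x)| * ((n + 1) * (2 * |x j|)) * (C * (r ^ 2 - ‖x‖ ^ 2)) := by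
              gcongr
              exact hC x hx
          _ = 2 * |x j| * (((t n x + 1) * |deriv S (t n x)|) * C) := by simp only [t]; ring
          _ ≤ 2 * r * (K * C) := by
              have : 0 ≤ t n x + 1 := by linarith
              gcongr
    · filter_upwards [hball_ae] with x hx
      refine tendsto_const_nhds.congr' ?_
      filter_upwards [(htlim x hx).eventually_gt_atTop 1] with n hn
      rw [hpd n j x hx, deriv_smoothTransition_of_one_lt hn, hS,
        Real.smoothTransition.one_of_one_le hn.le]
      simp
/-! ### Gradients of complex functions on the plane -/

/-- The real-linear map with given partial derivatives. -/
def gradCLM (c : Fin 2 → ℂ) : Plane →L[ℝ] ℂ :=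
  ∑ j, (EuclideanSpace.proj j : Plane →L[ℝ] ℝ).smulRight (c j)

theorem gradCLM_apply (c : Fin 2 → ℂ) (v : Plane) : gradCLM c v = v 0 * c 0 + v 1 * c 1 := by
  simp [gradCLM, Fin.sum_univ_two]

theorem gradCLM_eq_iff {L : Plane →L[ℝ] ℂ} {c : Fin 2 → ℂ} :
    L = gradCLM c ↔ ∀ j, L (EuclideanSpace.single j 1) = c j := by
  constructor
  · rintro rfl j
    rw [gradCLM_apply]
    fin_cases j <;> simp
  · intro h
    ext v
    have hv : v = v 0 • EuclideanSpace.single 0 1 + v 1 • EuclideanSpace.single 1 1 := by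
      ext j
      fin_cases j <;> simp
    rw [gradCLM_apply]
    conv_lhs => rw [hv]
    rw [map_add, map_smul, map_smul, h, h, Complex.real_smul, Complex.real_smul]

/-- `f` is differentiable at `x` with partial derivatives `f'`. -/
def HasGrad (f : Plane → ℂ) (f' : Fin 2 → ℂ) (x : Plane) : Prop := HasFDerivAt f (gradCLM f') x

theorem HasFDerivAt.hasGrad {f : Plane → ℂ} {L : Plane →L[ℝ] ℂ} {f' : Fin 2 → ℂ} {x : Plane}
    (h : HasFDerivAt f L x) (hL : ∀ j, L (EuclideanSpace.single j 1) = f' j) : HasGrad f f' x := by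
  rw [HasGrad, ← gradCLM_eq_iff.2 hL]
  exact h

theorem HasGrad.fderiv_single {f : Plane → ℂ} {f' : Fin 2 → ℂ} {x : Plane} (h : HasGrad f f' x)
    (j : Fin 2) : fderiv ℝ f x (EuclideanSpace.single j 1) = f' j :=
  gradCLM_eq_iff.1 (HasFDerivAt.fderiv h) j

theorem HasGrad.mul {f g : Plane → ℂ} {f' g' : Fin 2 → ℂ} {x : Plane} (hf : HasGrad f f' x)
    (hg : HasGrad g g' x) :
    HasGrad (fun y => f y * g y) (fun j => f' j * g x + f x * g' j) x :=
  HasFDerivAt.hasGrad (HasFDerivAt.mul hf hg) fun j => by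
    have h1 := gradCLM_eq_iff.1 (rfl : gradCLM f' = gradCLM f') j
    have h2 := gradCLM_eq_iff.1 (rfl : gradCLM g' = gradCLM g') j
    simp only [add_apply, smul_apply, h1, h2, smul_eq_mul]
    ring

theorem HasGrad.add {f g : Plane → ℂ} {f' g' : Fin 2 → ℂ} {x : Plane} (hf : HasGrad f f' x)
    (hg : HasGrad g g' x) : HasGrad (fun y => f y + g y) (fun j => f' j + g' j) x :=
  HasFDerivAt.hasGrad (HasFDerivAt.add hf hg) fun j => by
    rw [add_apply, gradCLM_eq_iff.1 rfl j, gradCLM_eq_iff.1 rfl j]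

theorem HasGrad.const_mul {f : Plane → ℂ} {f' : Fin 2 → ℂ} {x : Plane} (hf : HasGrad f f' x)
    (c : ℂ) : HasGrad (fun y => c * f y) (fun j => c * f' j) x :=
  HasFDerivAt.hasGrad (HasFDerivAt.const_mul hf c) fun j => by
    rw [smul_apply, gradCLM_eq_iff.1 rfl j, smul_eq_mul]

theorem HasGrad.pow {f : Plane → ℂ} {f' : Fin 2 → ℂ} {x : Plane} (hf : HasGrad f f' x) (n : ℕ) :
    HasGrad (fun y => f y ^ n) (fun j => n * f x ^ (n - 1) * f' j) x :=
  HasFDerivAt.hasGrad (HasFDerivAt.pow hf n) fun j => by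
    rw [smul_apply, gradCLM_eq_iff.1 rfl j]
    simp

theorem hasGrad_coord (i : Fin 2) (x : Plane) :
    HasGrad (fun y => (y i : ℂ)) (fun j => if i = j then 1 else 0) x :=
  HasFDerivAt.hasGrad (Complex.ofRealCLM.hasFDerivAt.comp x
    (EuclideanSpace.proj i : Plane →L[ℝ] ℝ).hasFDerivAt) fun j => by
    fin_cases i <;> fin_cases j <;> simp

theorem hasGrad_radial {ρ : ℝ → ℝ} {ρ' : ℝ} (x : Plane)
    (h : HasDerivAt ρ ρ' (x 0 ^ 2 + x 1 ^ 2)) :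
    HasGrad (fun y => (ρ (y 0 ^ 2 + y 1 ^ 2) : ℂ)) (fun j => 2 * x j * ρ') x := by
  have hp : ∀ i, HasFDerivAt (fun y : Plane => y i) (EuclideanSpace.proj i : Plane →L[ℝ] ℝ) x :=
    fun i => (EuclideanSpace.proj i : Plane →L[ℝ] ℝ).hasFDerivAt
  refine HasFDerivAt.hasGrad (Complex.ofRealCLM.hasFDerivAt.comp x
    (h.comp_hasFDerivAt x (((hp 0).pow 2).add ((hp 1).pow 2)))) fun j => ?_
  fin_cases j <;> simp <;> ring

theorem contDiffOn_one_of_hasGrad {s : Set Plane} (hs : IsOpen s) {f : Plane → ℂ}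
    {f' : Plane → Fin 2 → ℂ} (hf : ∀ x ∈ s, HasGrad f (f' x) x)
    (hf' : ∀ j, ContinuousOn (fun x => f' x j) s) : ContDiffOn ℝ 1 f s := by
  rw [show (1 : ℕ∞ω) = 0 + 1 from rfl, contDiffOn_succ_iff_fderiv_of_isOpen hs]
  refine ⟨fun x hx => (HasFDerivAt.differentiableAt (hf x hx)).differentiableWithinAt, by simp,
    contDiffOn_zero.2 ?_⟩
  have : ContinuousOn (fun x => gradCLM (f' x)) s := by
    unfold gradCLM
    refine continuousOn_finsetSum _ fun j _ => ?_
    exact ((ContinuousLinearMap.smulRightL ℝ Plane ℂ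
      (EuclideanSpace.proj j : Plane →L[ℝ] ℝ)).continuous).comp_continuousOn (hf' j)
  exact this.congr fun x hx => HasFDerivAt.fderiv (hf x hx)

/-! ### Gauge transformations -/

/-- The vector potential of the homogeneous magnetic field `B`, in the symmetric gauge. -/
def symmPotential (B : ℝ) (j : Fin 2) (x : Plane) : ℝ :=
  if j = 0 then -(B / 2) * x 1 else B / 2 * x 0

theorem continuous_symmPotential (B : ℝ) (j : Fin 2) : Continuous (symmPotential B j) := by
  unfold symmPotential
  split_ifs <;> fun_prop

/-- `E` is the gauge factor on the disc of radius `r` that turns the symmetric gauge into `A`. -/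
structure IsGauge (B r : ℝ) (A : Plane → Plane) (E : Plane → ℂ) : Prop where
  norm_eq : ∀ x ∈ Metric.ball (0 : Plane) r, ‖E x‖ = 1
  hasGrad : ∀ x ∈ Metric.ball (0 : Plane) r,
    HasGrad E (fun j => Complex.I * (A x j - symmPotential B j x : ℝ) * E x) x

/-- Poincaré's lemma on the convex disc: `θ`, the difference of the two potentials, is closed
because both have curl `B`, and `E` is the exponential of `i` times a primitive. -/
theorem exists_isGauge {B r : ℝ} {A : Plane → Plane} (hA : ContDiff ℝ 1 A)
    (hcurl : ∀ x ∈ Metric.ball (0 : Plane) r, magneticField A x = B) : ∃ E, IsGauge B r A E := by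
  let p : Fin 2 → Plane →L[ℝ] ℝ := fun j => EuclideanSpace.proj j
  let θ : Plane → Plane →L[ℝ] ℝ := fun x => (A x 0 + B / 2 * x 1) • p 0 + (A x 1 - B / 2 * x 0) • p 1
  have hAj : ∀ j x, DifferentiableAt ℝ (fun y => A y j) x := fun j x =>
    (p j).differentiableAt.comp x (hA.differentiable (by simp) x)
  have hθ : ∀ a, HasFDerivAt θ
      (((fderiv ℝ (fun y => A y 0) a + (B / 2) • p 1).smulRight (p 0)) +
        ((fderiv ℝ (fun y => A y 1) a - (B / 2) • p 0).smulRight (p 1))) a := fun a =>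
    (((hAj 0 a).hasFDerivAt.add ((p 1).hasFDerivAt.const_mul (B / 2))).smul_const (p 0)).add
      (((hAj 1 a).hasFDerivAt.sub ((p 0).hasFDerivAt.const_mul (B / 2))).smul_const (p 1))
  have hd : DifferentiableOn ℝ θ (Metric.ball 0 r) := fun a _ =>
    (hθ a).differentiableAt.differentiableWithinAt
  have hp : ∀ j v, p j v = v j := fun _ _ => rfl
  obtain ⟨φ, hφ⟩ := (convex_ball (0 : Plane) r).exists_forall_hasFDerivAt_of_fderiv_symmetric
    Metric.isOpen_ball hd
    fun a ha x y => by
      have hc := hcurl a ha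
      rw [magneticField, partialDeriv, partialDeriv] at hc
      have hv : ∀ v : Plane, v = v 0 • EuclideanSpace.single 0 1 + v 1 • EuclideanSpace.single 1 1 :=
        fun v => by ext j; fin_cases j <;> simp
      have hL : ∀ (L : Plane →L[ℝ] ℝ) (v : Plane), L v =
          v 0 * L (EuclideanSpace.single 0 1) + v 1 * L (EuclideanSpace.single 1 1) := fun L v => by
        conv_lhs => rw [hv v]
        rw [map_add, map_smul, map_smul, smul_eq_mul, smul_eq_mul]
      rw [(hθ a).fderiv]
      simp only [add_apply, sub_apply, ContinuousLinearMap.smulRight_apply, smul_apply,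
        smul_eq_mul, hp]
      rw [hL (fderiv ℝ (fun y => A y 0) a) x, hL (fderiv ℝ (fun y => A y 0) a) y,
        hL (fderiv ℝ (fun y => A y 1) a) x, hL (fderiv ℝ (fun y => A y 1) a) y]
      -- The antisymmetric part of the derivative of `θ` is `curl A - B` times the area form.
      linear_combination (x 0 * y 1 - x 1 * y 0) * hc
  refine ⟨fun x => Complex.exp (Complex.I * φ x), fun x _ => ?_, fun x hx => ?_⟩
  · rw [mul_comm, Complex.norm_exp_ofReal_mul_I]
  · refine HasFDerivAt.hasGrad ((Complex.ofRealCLM.hasFDerivAt.comp x (hφ x hx)).const_mul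
      Complex.I).cexp fun j => ?_
    fin_cases j <;> simp [θ, p, symmPotential] <;> ring

theorem IsGauge.continuousOn {B r : ℝ} {A : Plane → Plane} {E : Plane → ℂ} (hE : IsGauge B r A E) :
    ContinuousOn E (Metric.ball 0 r) := fun x hx =>
  (HasFDerivAt.continuousAt (hE.hasGrad x hx)).continuousWithinAt

theorem exists_bound_on_ball {h : Plane → ℂ} (hh : Continuous h) (r : ℝ) :
    ∃ C, ∀ x ∈ Metric.ball (0 : Plane) r, ‖h x‖ ≤ C := by
  obtain ⟨C, hC⟩ := (isCompact_closedBall (0 : Plane) r).exists_bound_of_continuousOn hh.continuousOn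
  exact ⟨C, fun x hx => hC x (Metric.ball_subset_closedBall hx)⟩

theorem IsGauge.memLp {B r : ℝ} {A : Plane → Plane} {E : Plane → ℂ} (hE : IsGauge B r A E)
    {h : Plane → ℂ} (hh : Continuous h) :
    MemLp (fun x => E x * h x) 2 (volume.restrict (Metric.ball 0 r)) := by
  obtain ⟨C, hC⟩ := exists_bound_on_ball hh r
  refine MemLp.of_bound ((hE.continuousOn.mul hh.continuousOn).aestronglyMeasurable
    measurableSet_ball) C ?_
  filter_upwards [ae_restrict_mem measurableSet_ball] with x hx
  rw [norm_mul, hE.norm_eq x hx, one_mul]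
  exact hC x hx

/-- The element `E h` of `L²` of the disc. -/
def IsGauge.toL2 {B r : ℝ} {A : Plane → Plane} {E : Plane → ℂ} (hE : IsGauge B r A E)
    {h : Plane → ℂ} (hh : Continuous h) : L2 (Metric.ball (0 : Plane) r) := (hE.memLp hh).toLp _

theorem IsGauge.coeFn_toL2 {B r : ℝ} {A : Plane → Plane} {E : Plane → ℂ} (hE : IsGauge B r A E)
    {h : Plane → ℂ} (hh : Continuous h) :
    hE.toL2 hh =ᵐ[volume.restrict (Metric.ball 0 r)] fun x => E x * h x :=
  (hE.memLp hh).coeFn_toLp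

/-- Integration by parts against a test function. -/
theorem integral_conj_partialDeriv_mul {Ω : Set Plane} {φ : Plane → ℂ} (hφ : ContDiff ℝ 1 φ)
    (cφ : HasCompactSupport φ) (sφ : tsupport φ ⊆ Ω) {k : Plane → ℂ} {k' : Plane → Fin 2 → ℂ}
    (hk : ∀ x ∈ Ω, HasGrad k (k' x) x) (j : Fin 2) (hk' : ContinuousOn (fun x => k' x j) Ω) :
    ∫ x in Ω, (starRingEnd ℂ) (partialDeriv j φ x) * k x =
      -∫ x in Ω, (starRingEnd ℂ) (φ x) * k' x j := by
  have ck : ContinuousOn k Ω := fun x hx => (HasFDerivAt.continuousAt (hk x hx)).continuousWithinAt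
  have cd := continuous_partialDeriv hφ j
  have zφ : ∀ x ∉ tsupport φ, φ x = 0 := fun x => image_eq_zero_of_notMem_tsupport
  have zd : ∀ x ∉ tsupport φ, partialDeriv j φ x = 0 := fun x hx => by
    rw [partialDeriv, image_eq_zero_of_notMem_tsupport fun h => hx (tsupport_fderiv_subset ℝ h)]
    simp
  have hint : ∀ a b : Plane → ℂ, Continuous a → (∀ x ∉ tsupport φ, a x = 0) → ContinuousOn b Ω →
      Integrable fun x => (starRingEnd ℂ) (a x) * b x := by
    intro a b ha za hb
    refine IntegrableOn.integrable_of_forall_notMem_eq_zero (s := tsupport φ)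
      (ContinuousOn.integrableOn_compact cφ.isCompact ?_) fun x hx => by simp [za x hx]
    exact (Complex.continuous_conj.comp ha).continuousOn.mul (hb.mono sφ)
  rw [setIntegral_eq_integral_of_forall_compl_eq_zero fun x hx => by
      rw [zd x fun h => hx (sφ h), map_zero, zero_mul],
    setIntegral_eq_integral_of_forall_compl_eq_zero fun x hx => by
      rw [zφ x fun h => hx (sφ h), map_zero, zero_mul]]
  -- Differentiability of `k` is needed only on the support of `φ`, which lies in `Ω`.
  have key := integral_bilinear_hasLineDerivAt_right_eq_neg_left_of_integrable
    (μ := (volume : Measure Plane)) (B := ContinuousLinearMap.mul ℝ ℂ)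
    (f := fun x => (starRingEnd ℂ) (φ x)) (f' := fun x => (starRingEnd ℂ) (partialDeriv j φ x))
    (g := k) (g' := fun x => k' x j) (v := EuclideanSpace.single j 1)
    (hint _ _ cd zd ck) (hint _ _ hφ.continuous zφ hk') (hint _ _ hφ.continuous zφ ck)
    (fun x _ => ?_) (fun x hx => ?_)
  · simp only [ContinuousLinearMap.mul_apply'] at key
    rw [key, neg_neg]
  · have h1 := ((hφ.differentiable (by simp) x).hasFDerivAt)
    exact (Complex.conjCLE.toContinuousLinearMap.hasFDerivAt.comp x h1).hasLineDerivAt _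
  · have hx' : x ∈ Ω := sφ (closure_mono (Function.support_comp_subset (map_zero _) φ) hx)
    have h1 := (HasFDerivAt.hasLineDerivAt (hk x hx') (EuclideanSpace.single j 1))
    rwa [gradCLM_eq_iff.1 rfl j] at h1

/-- A weak equation for test functions extends to `H¹₀`. -/
theorem weak_eq_of_mem_sobolevGraph {Ω : Set Plane} {G H : Fin 2 → L2 Ω} {f : L2 Ω}
    (h : ∀ p ∈ testGraph Ω,
      ∑ j, (inner ℂ (Complex.I • p.2 j) (G j) + inner ℂ p.1 (H j)) = inner ℂ p.1 f)
    {p : L2 Ω × (Fin 2 → L2 Ω)} (hp : p ∈ sobolevGraph Ω) :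
    ∑ j, (inner ℂ (Complex.I • p.2 j) (G j) + inner ℂ p.1 (H j)) = inner ℂ p.1 f := by
  have hc : IsClosed {p : L2 Ω × (Fin 2 → L2 Ω) |
      ∑ j, (inner ℂ (Complex.I • p.2 j) (G j) + inner ℂ p.1 (H j)) = inner ℂ p.1 f} :=
    isClosed_eq (by fun_prop) (by fun_prop)
  exact closure_minimal h hc hp

/-- Classical functions that vanish linearly at the boundary of the disc belong to the domain of the
magnetic Dirichlet Laplacian. -/
theorem IsGauge.mem_magneticDirichletGraph {B r : ℝ} (hr : 0 < r) {A : Plane → Plane}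
    (hA : Continuous A) {E : Plane → ℂ} (hE : IsGauge B r A E) {w : Plane → ℂ}
    {w' : Plane → Fin 2 → ℂ} {F : Fin 2 → Plane → ℂ} {F' : Fin 2 → Plane → Fin 2 → ℂ}
    {h : Plane → ℂ} (hw : ∀ x, HasGrad w (w' x) x) (cw' : ∀ j, Continuous fun x => w' x j)
    (hF : ∀ j x, F j x = Complex.I * w' x j + symmPotential B j x * w x)
    (hF' : ∀ j x, HasGrad (F j) (F' j x) x) (cF' : ∀ j, Continuous fun x => F' j x j)
    {C : ℝ} (hC : ∀ x ∈ Metric.ball (0 : Plane) r, ‖w x‖ ≤ C * (r ^ 2 - ‖x‖ ^ 2))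
    (cw : Continuous w) (ch : Continuous h)
    (hh : ∀ x, h x = ∑ j, (Complex.I * F' j x j + symmPotential B j x * F j x)) :
    (hE.toL2 cw, hE.toL2 ch) ∈ magneticDirichletGraph (Metric.ball 0 r) A := by
  have cS := continuous_symmPotential B
  have cA : ∀ j, Continuous fun x => A x j := fun j => by fun_prop
  have cF : ∀ j, Continuous (F j) := fun j => by
    rw [funext (hF j)]
    have := cS j
    have := cw' j
    fun_prop
  have cv' : ∀ j, Continuous fun x => Complex.I * (A x j - symmPotential B j x : ℝ) * w x + w' x j :=
    fun j => by
      have := cS j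
      have := cw' j
      have := cA j
      fun_prop
  have cAF : ∀ j, Continuous fun x => (A x j : ℂ) * F j x := fun j => by
    have := cF j
    have := cA j
    fun_prop
  have hv : ∀ x ∈ Metric.ball (0 : Plane) r, HasGrad (fun y => E y * w y)
      (fun j => E x * (Complex.I * (A x j - symmPotential B j x : ℝ) * w x + w' x j)) x := by
    intro x hx
    convert (hE.hasGrad x hx).mul (hw x) using 2 with j
    ring
  -- membership in the form domain
  have hgrad : (hE.toL2 cw, fun j => hE.toL2 (cF j)) ∈ magneticGradientGraph (Metric.ball 0 r) A := by
    refine ⟨fun j => hE.toL2 (cv' j), ?_, fun j => ?_⟩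
    · choose D hD using fun j => exists_bound_on_ball (cv' j) r
      refine mem_sobolevGraph_of_vanishing hr (v := fun y => E y * w y)
        (contDiffOn_one_of_hasGrad Metric.isOpen_ball hv
          fun j => hE.continuousOn.mul (cv' j).continuousOn) (C := max C (max (D 0) (D 1)))
        (fun x hx => ?_) (fun x hx j => ?_) (hE.coeFn_toL2 cw) fun j => ?_
      · rw [norm_mul, hE.norm_eq x hx, one_mul]
        refine (hC x hx).trans (mul_le_mul_of_nonneg_right (le_max_left _ _) ?_)
        have := mem_ball_zero_iff.1 hx
        nlinarith [norm_nonneg x]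
      · rw [partialDeriv, (hv x hx).fderiv_single, norm_mul, hE.norm_eq x hx, one_mul]
        refine (hD j x hx).trans (le_trans ?_ (le_max_right _ _))
        fin_cases j
        · exact le_max_left _ _
        · exact le_max_right _ _
      · filter_upwards [hE.coeFn_toL2 (cv' j), ae_restrict_mem measurableSet_ball] with x h1 hx
        rw [h1, partialDeriv, (hv x hx).fderiv_single]
    · filter_upwards [hE.coeFn_toL2 (cv' j), hE.coeFn_toL2 (cF j), hE.coeFn_toL2 cw] with x h1 h2 h3
      simp only [h1, h2, h3, hF]
      push_cast
      linear_combination (-(A x j - symmPotential B j x : ℂ) * w x * E x) * Complex.I_sq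
  refine ⟨_, hgrad, ?_⟩
  -- The weak equation is first obtained for test functions by integrating by parts. Differentiating
  -- `E` produces `A` minus the symmetric potential, which cancels against the term with `A` and
  -- leaves the symmetric-gauge expression `h`.
  have htest : ∀ p ∈ testGraph (Metric.ball (0 : Plane) r),
      ∑ j, (inner ℂ (Complex.I • p.2 j) (hE.toL2 (cF j)) + inner ℂ p.1 (hE.toL2 (cAF j))) =
        inner ℂ p.1 (hE.toL2 ch) := by
    rintro p ⟨φ, hφ, cφ, sφ, e, d⟩
    have cd : ∀ j, Continuous fun x =>
        Complex.I * (Complex.I * (A x j - symmPotential B j x : ℝ) * F j x + F' j x j) := fun j => by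
      have := cS j
      have := cF j
      have := cF' j
      have := cA j
      fun_prop
    have hj : ∀ j, inner ℂ (Complex.I • p.2 j) (hE.toL2 (cF j)) = inner ℂ p.1 (hE.toL2 (cd j)) := by
      intro j
      have hk : ∀ x ∈ Metric.ball (0 : Plane) r, HasGrad (fun y => E y * F j y) (fun i =>
          E x * (Complex.I * (A x i - symmPotential B i x : ℝ) * F j x + F' j x i)) x := by
        intro x hx
        convert (hE.hasGrad x hx).mul (hF' j x) using 2 with i
        ring
      have ck : Continuous fun x =>
          Complex.I * (A x j - symmPotential B j x : ℝ) * F j x + F' j x j := by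
        have := cS j
        have := cF j
        have := cF' j
        have := cA j
        fun_prop
      have ibp := integral_conj_partialDeriv_mul (hφ.of_le (by simp)) cφ sφ hk j
        (hE.continuousOn.mul ck.continuousOn)
      rw [L2.inner_def, L2.inner_def]
      calc _ = ∫ x in Metric.ball (0 : Plane) r,
            -Complex.I * ((starRingEnd ℂ) (partialDeriv j φ x) * (E x * F j x)) := by
            refine integral_congr_ae ?_
            filter_upwards [d j, Lp.coeFn_smul Complex.I (p.2 j), hE.coeFn_toL2 (cF j)]
              with x h1 h2 h3
            rw [h2, Pi.smul_apply, h1, h3]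
            simp
            ring
        _ = ∫ x in Metric.ball (0 : Plane) r, Complex.I * ((starRingEnd ℂ) (φ x) *
            (E x * (Complex.I * (A x j - symmPotential B j x : ℝ) * F j x + F' j x j))) := by
            rw [integral_const_mul, ibp, integral_const_mul]
            ring
        _ = _ := by
            refine integral_congr_ae ?_
            filter_upwards [e, hE.coeFn_toL2 (cd j)] with x h1 h2
            rw [h1, h2]
            simp
            ring
    simp only [hj, ← inner_add_right, ← inner_sum]
    congr 1
    rw [Fin.sum_univ_two]
    refine Lp.ext ?_
    filter_upwards [Lp.coeFn_add (hE.toL2 (cd 0) + hE.toL2 (cAF 0))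
      (hE.toL2 (cd 1) + hE.toL2 (cAF 1)), Lp.coeFn_add (hE.toL2 (cd 0)) (hE.toL2 (cAF 0)),
      Lp.coeFn_add (hE.toL2 (cd 1)) (hE.toL2 (cAF 1)), hE.coeFn_toL2 (cd 0), hE.coeFn_toL2 (cd 1),
      hE.coeFn_toL2 (cAF 0), hE.coeFn_toL2 (cAF 1), hE.coeFn_toL2 ch] with x h1 h2 h3 h4 h5 h6 h7 h8
    rw [h1, Pi.add_apply, h2, h3, Pi.add_apply, Pi.add_apply, h4, h5, h6, h7, h8, hh x,
      Fin.sum_univ_two]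
    push_cast
    linear_combination (E x * ((A x 0 - symmPotential B 0 x) * F 0 x +
      (A x 1 - symmPotential B 1 x) * F 1 x)) * Complex.I_sq
  -- By density the weak equation holds on all of `H¹₀`. Since `A` is real, the term `A * q.1` of
  -- the magnetic gradient can be moved to the other side of the inner product.
  rintro q ⟨g, hg, hq⟩
  rw [← weak_eq_of_mem_sobolevGraph htest hg]
  refine Finset.sum_congr rfl fun j _ => ?_
  have h1 : q.2 j = Complex.I • g j + (q.2 j - Complex.I • g j) := by abel
  rw [h1, inner_add_left]
  congr 1
  rw [L2.inner_def, L2.inner_def]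
  refine integral_congr_ae ?_
  filter_upwards [hq j, Lp.coeFn_sub (q.2 j) (Complex.I • g j), Lp.coeFn_smul Complex.I (g j),
    hE.coeFn_toL2 (cF j), hE.coeFn_toL2 (cAF j)] with x h1 h2 h3 h4 h5
  rw [h2, Pi.sub_apply, h1, h3, h4, h5]
  simp
  ring
/-! ### Angular modes -/

/-- The sign of the angular momentum. -/
def angSign (m : ℤ) : ℂ := if 0 ≤ m then 1 else -1

theorem angSign_sq (m : ℤ) : angSign m ^ 2 = 1 := by
  unfold angSign
  split_ifs <;> norm_num

theorem angSign_mul_natAbs (m : ℤ) : angSign m * (m.natAbs : ℂ) = m := by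
  unfold angSign
  rw [Nat.cast_natAbs]
  split_ifs with h0
  · rw [abs_of_nonneg h0, one_mul]
  · rw [abs_of_neg (not_le.1 h0)]
    push_cast
    ring

/-- The complex coordinate `x₁ + i x₂` if `0 ≤ m`, and its conjugate if `m < 0`. -/
def angCoord (m : ℤ) (x : Plane) : ℂ := x 0 + angSign m * Complex.I * x 1

/-- The factor `exp (-B t / 4) g (B t / 2)`. -/
def radial (B : ℝ) (g : ℝ → ℝ) (t : ℝ) : ℝ := Real.exp (-(B / 4) * t) * g (B / 2 * t)

/-- The function `r ^ |m| exp (i m θ) exp (-B r ^ 2 / 4) g (B r ^ 2 / 2)` in polar coordinates. -/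
def mode (B : ℝ) (m : ℤ) (g : ℝ → ℝ) (x : Plane) : ℂ :=
  angCoord m x ^ m.natAbs * radial B g (x 0 ^ 2 + x 1 ^ 2)

theorem continuous_angCoord (m : ℤ) : Continuous (angCoord m) := by
  unfold angCoord
  fun_prop

theorem continuous_radial (B : ℝ) {g : ℝ → ℝ} (hg : Continuous g) : Continuous (radial B g) := by
  unfold radial
  fun_prop

theorem continuous_mode (B : ℝ) (m : ℤ) {g : ℝ → ℝ} (hg : Continuous g) :
    Continuous (mode B m g) := by
  have := continuous_angCoord m
  have := continuous_radial B hg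
  unfold mode
  fun_prop

theorem hasDerivAt_radial (B : ℝ) {g g₁ : ℝ → ℝ} (hg : ∀ s, HasDerivAt g (g₁ s) s) (t : ℝ) :
    HasDerivAt (radial B g) (radial B (fun s => B / 2 * g₁ s - B / 4 * g s) t) t := by
  have h1 : HasDerivAt (fun t : ℝ => Real.exp (-(B / 4) * t)) _ t :=
    ((hasDerivAt_id t).const_mul (-(B / 4))).exp
  have h2 : HasDerivAt (fun t : ℝ => g (B / 2 * t)) _ t :=
    (hg (B / 2 * t)).comp t ((hasDerivAt_id t).const_mul (B / 2))
  refine (h1.mul h2).congr_deriv ?_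
  simp only [radial, id]
  ring

/-- The partial derivatives of `angCoord`. -/
def angDir (m : ℤ) (j : Fin 2) : ℂ := if j = 0 then 1 else angSign m * Complex.I

theorem hasGrad_angCoord (m : ℤ) (x : Plane) : HasGrad (angCoord m) (angDir m) x := by
  have e : angDir m = fun j => (if 0 = j then 1 else 0) +
      angSign m * Complex.I * (if 1 = j then 1 else 0) := by
    funext j
    fin_cases j <;> simp [angDir]
  rw [e]
  exact (hasGrad_coord 0 x).add ((hasGrad_coord 1 x).const_mul (angSign m * Complex.I))

theorem hasGrad_symmPotential (B : ℝ) (j : Fin 2) (x : Plane) :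
    HasGrad (fun y => (symmPotential B j y : ℂ))
      (fun i => if j = i then 0 else if j = 0 then -(B / 2 : ℂ) else B / 2) x := by
  fin_cases j
  · convert (hasGrad_coord 1 x).const_mul (-(B / 2 : ℂ)) using 2 with y i
    · simp [symmPotential]
    · fin_cases i <;> simp
  · convert (hasGrad_coord 0 x).const_mul (B / 2 : ℂ) using 2 with y i
    · simp [symmPotential]
    · fin_cases i <;> simp

/-- The computation of `(i∇ + A)²` on an angular mode in the symmetric gauge. -/
theorem mode_identity {X Y B σ τ n m P Q R e g g₁ g₂ : ℂ} (hτ : τ ^ 2 = -1)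
    (hIτ : Complex.I * τ = -σ) (hQ : Q * (X + τ * Y) = n * P) (hm : σ * n = m)
    {ρ ρ₁ ρ₂ : ℂ} (hρ : ρ = e * g) (hρ₁ : ρ₁ = e * (B / 2 * g₁ - B / 4 * g))
    (hρ₂ : ρ₂ = e * (B / 2 * (B / 2 * g₂ - B / 4 * g₁) - B / 4 * (B / 2 * g₁ - B / 4 * g))) :
    Complex.I * (Complex.I * (R * ρ + 2 * (Q * (2 * X * ρ₁)) + P * (2 * ρ₁ + 4 * X ^ 2 * ρ₂)) +
        -(B / 2) * Y * (Q * ρ + P * (2 * X * ρ₁))) +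
      -(B / 2) * Y * (Complex.I * (Q * ρ + P * (2 * X * ρ₁)) + -(B / 2) * Y * (P * ρ)) +
      (Complex.I * (Complex.I * (R * τ ^ 2 * ρ + 2 * (Q * τ * (2 * Y * ρ₁)) +
          P * (2 * ρ₁ + 4 * Y ^ 2 * ρ₂)) + B / 2 * X * (Q * τ * ρ + P * (2 * Y * ρ₁))) +
        B / 2 * X * (Complex.I * (Q * τ * ρ + P * (2 * Y * ρ₁)) + B / 2 * X * (P * ρ))) =
    P * (e * (B * (n + 1 - m) * g - 2 * B * (B / 2 * (X ^ 2 + Y ^ 2) * g₂ +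
      (n + 1 - B / 2 * (X ^ 2 + Y ^ 2)) * g₁))) := by
  have hI := Complex.I_sq
  subst hρ hρ₁ hρ₂
  -- Here `P, Q, R` stand for `ζ^n` and its first two derivatives in `ζ`. Harmonicity `1 + τ² = 0`
  -- removes `R`, Euler's identity `hQ` turns `Q` into `n P`, and `hIτ` with `hm` yields the
  -- angular-momentum term `-B m`.
  linear_combination
    (R * (e * g) * (1 + τ ^ 2) + 4 * (e * (B / 2 * g₁ - B / 4 * g)) * (Q * (X + τ * Y)) +
      P * (4 * (e * (B / 2 * g₁ - B / 4 * g)) + 4 * (X ^ 2 + Y ^ 2) *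
        (e * (B / 2 * (B / 2 * g₂ - B / 4 * g₁) - B / 4 * (B / 2 * g₁ - B / 4 * g))))) * hI
    - R * (e * g) * hτ - 4 * (e * (B / 2 * g₁ - B / 4 * g)) * hQ
    + Complex.I * B * (e * g) * τ * hQ - Complex.I * B * (e * g) * Q * Y * hτ
    + B * (e * g) * n * P * hIτ - B * P * (e * g) * hm

/-- A mode vanishing on the circle of radius `r` vanishes linearly there. -/
theorem exists_mode_bound {B r : ℝ} {m : ℤ} {g g₁ : ℝ → ℝ}
    (hg : ∀ s, HasDerivAt g (g₁ s) s) (hg₁ : Continuous g₁) (h0 : g (B / 2 * r ^ 2) = 0) :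
    ∃ C, ∀ x ∈ Metric.ball (0 : Plane) r, ‖mode B m g x‖ ≤ C * (r ^ 2 - ‖x‖ ^ 2) := by
  have cg : Continuous g := continuous_iff_continuousAt.2 fun s => (hg s).continuousAt
  obtain ⟨D, hD⟩ := exists_bound_on_ball ((continuous_angCoord m).pow m.natAbs) r
  obtain ⟨K, hK⟩ := isCompact_Icc.exists_bound_of_continuousOn (s := Set.Icc 0 (r ^ 2))
    (continuous_radial B (g := fun s => B / 2 * g₁ s - B / 4 * g s) (by fun_prop)).continuousOn
  refine ⟨D * K, fun x hx => ?_⟩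
  have hx2 : ‖x‖ ^ 2 = x 0 ^ 2 + x 1 ^ 2 := by
    rw [EuclideanSpace.norm_sq_eq, Fin.sum_univ_two, Real.norm_eq_abs, Real.norm_eq_abs, sq_abs,
      sq_abs]
  have hxr : ‖x‖ ^ 2 ≤ r ^ 2 := by
    have := mem_ball_zero_iff.1 hx
    exact pow_le_pow_left₀ (norm_nonneg _) this.le 2
  -- Mean value inequality in the variable `t = |x|²` between `|x|²` and `r²`, where the radial
  -- factor vanishes.
  have hmv := (convex_Icc (0 : ℝ) (r ^ 2)).norm_image_sub_le_of_norm_hasDerivWithin_le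
    (fun t _ => (hasDerivAt_radial B hg t).hasDerivWithinAt) hK
    (Set.right_mem_Icc.2 (sq_nonneg r)) ⟨sq_nonneg ‖x‖, hxr⟩
  have hr0 : radial B g (r ^ 2) = 0 := by rw [radial, h0, mul_zero]
  rw [hr0, sub_zero, Real.norm_eq_abs (_ - _), abs_sub_comm, abs_of_nonneg (by linarith)] at hmv
  rw [mode, norm_mul, ← hx2, Complex.norm_real, mul_assoc]
  exact mul_le_mul (hD x hx) hmv (norm_nonneg _) ((norm_nonneg _).trans (hD x hx))

/-- The magnetic Dirichlet Laplacian acts on angular modes by the Kummer operator. -/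
theorem IsGauge.mode_mem_graph {B r : ℝ} (hr : 0 < r) {A : Plane → Plane}
    (hA : Continuous A) {E : Plane → ℂ} (hE : IsGauge B r A E) (m : ℤ) {a : ℝ} {g h : ℝ → ℝ}
    (hg : SolvesKummer a (m.natAbs + 1) g h) (h0 : g (B / 2 * r ^ 2) = 0)
    (cg : Continuous g)
    (ch : Continuous fun s => B * (m.natAbs + 1 - m - 2 * a) * g s - 2 * B * h s) :
    (hE.toL2 (continuous_mode B m cg), hE.toL2 (continuous_mode B m ch)) ∈
      magneticDirichletGraph (Metric.ball 0 r) A := by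
  obtain ⟨g₁, g₂, hg1, hg2, cg2, hode⟩ := hg
  have cg1 : Continuous g₁ := continuous_iff_continuousAt.2 fun s => (hg2 s).continuousAt
  obtain ⟨C, hC⟩ := exists_mode_bound (m := m) hg1 cg1 h0
  set n := m.natAbs with hn
  set G₁ : ℝ → ℝ := fun s => B / 2 * g₁ s - B / 4 * g s with hG₁
  set G₂ : ℝ → ℝ := fun s => B / 2 * (B / 2 * g₂ s - B / 4 * g₁ s) - B / 4 * G₁ s with hG₂
  have hG1 : ∀ s, HasDerivAt G₁ (B / 2 * g₂ s - B / 4 * g₁ s) s := fun s =>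
    ((hg2 s).const_mul _).sub ((hg1 s).const_mul _)
  have cG1 : Continuous G₁ := by fun_prop
  have cG2 : Continuous G₂ := by fun_prop
  let ρ₁ : Plane → ℂ := fun x => radial B G₁ (x 0 ^ 2 + x 1 ^ 2)
  let ρ₂ : Plane → ℂ := fun x => radial B G₂ (x 0 ^ 2 + x 1 ^ 2)
  let ρ : Plane → ℂ := fun x => radial B g (x 0 ^ 2 + x 1 ^ 2)
  have cρ : Continuous ρ := by have := continuous_radial B cg; fun_prop
  have cρ₁ : Continuous ρ₁ := by have := continuous_radial B cG1; fun_prop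
  have cρ₂ : Continuous ρ₂ := by have := continuous_radial B cG2; fun_prop
  have cζ := continuous_angCoord m
  have hρ : ∀ x, HasGrad ρ (fun j => 2 * x j * ρ₁ x) x := fun x =>
    hasGrad_radial x (hasDerivAt_radial B hg1 _)
  have hρ₁ : ∀ x, HasGrad ρ₁ (fun j => 2 * x j * ρ₂ x) x := fun x =>
    hasGrad_radial x (hasDerivAt_radial B hG1 _)
  let ζ := angCoord m
  let w' : Plane → Fin 2 → ℂ := fun x j =>
    n * ζ x ^ (n - 1) * angDir m j * ρ x + ζ x ^ n * (2 * x j * ρ₁ x)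
  have hw : ∀ x, HasGrad (mode B m g) (w' x) x := fun x =>
    ((hasGrad_angCoord m x).pow n).mul (hρ x)
  -- The truncated exponents `n - 1` and `n - 1 - 1` do no harm: for `n = 0` or `n = 1` the
  -- coefficients in front of them vanish.
  let w'' : Fin 2 → Plane → Fin 2 → ℂ := fun j x i =>
    angDir m j * (n * ((n - 1 : ℕ) * ζ x ^ (n - 1 - 1) * angDir m i) * ρ x +
      n * ζ x ^ (n - 1) * (2 * x i * ρ₁ x)) +
    (n * ζ x ^ (n - 1) * angDir m i * (2 * x j * ρ₁ x) +
      ζ x ^ n * (2 * (if j = i then 1 else 0) * ρ₁ x + 2 * x j * (2 * x i * ρ₂ x)))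
  have hw' : ∀ j x, HasGrad (fun y => w' y j) (w'' j x) x := by
    intro j x
    have hζ := hasGrad_angCoord m x
    have h1 := ((((hζ.pow (n - 1)).const_mul (n : ℂ)).mul (hρ x)).const_mul (angDir m j)).add
      ((hζ.pow n).mul (((hasGrad_coord j x).const_mul 2).mul (hρ₁ x)))
    have e : (fun y => w' y j) = fun y => angDir m j * (n * angCoord m y ^ (n - 1) * ρ y) +
        angCoord m y ^ n * (2 * (y j : ℂ) * ρ₁ y) := by
      funext y
      simp only [w', ζ]
      ring
    rw [e]
    exact h1
  let F : Fin 2 → Plane → ℂ := fun j x => Complex.I * w' x j + symmPotential B j x * mode B m g x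
  let F' : Fin 2 → Plane → Fin 2 → ℂ := fun j x i => Complex.I * w'' j x i +
    ((if j = i then 0 else if j = 0 then -(B / 2 : ℂ) else B / 2) * mode B m g x +
      symmPotential B j x * w' x i)
  have hF' : ∀ j x, HasGrad (F j) (F' j x) x := fun j x =>
    ((hw' j x).const_mul Complex.I).add ((hasGrad_symmPotential B j x).mul (hw x))
  have cw' : ∀ j, Continuous fun x => w' x j := fun j => by fun_prop
  have cF' : ∀ j, Continuous fun x => F' j x j := fun j => by
    have := continuous_mode B m cg
    have := continuous_symmPotential B j
    fun_prop
  refine hE.mem_magneticDirichletGraph hr hA hw cw' (F := F) (F' := F') (fun _ _ => rfl) hF' cF' hC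
    (continuous_mode B m cg) (continuous_mode B m ch) fun x => ?_
  have hτ : (angSign m * Complex.I) ^ 2 = -1 := by
    rw [mul_pow, angSign_sq, Complex.I_sq, one_mul]
  have hIτ : Complex.I * (angSign m * Complex.I) = -angSign m := by
    linear_combination angSign m * Complex.I_sq
  have hQ : (n * ζ x ^ (n - 1)) * (x 0 + angSign m * Complex.I * x 1) = n * ζ x ^ n := by
    rcases Nat.eq_zero_or_pos n with h | h
    · simp [h]
    · rw [mul_assoc]
      change (n : ℂ) * (ζ x ^ (n - 1) * ζ x) = _
      rw [pow_sub_one_mul h.ne']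
  have key := mode_identity (X := x 0) (Y := x 1) (B := B) (P := ζ x ^ n)
    (R := n * ((n - 1 : ℕ) * ζ x ^ (n - 1 - 1))) (e := Real.exp (-(B / 4) * (x 0 ^ 2 + x 1 ^ 2)))
    (g := g (B / 2 * (x 0 ^ 2 + x 1 ^ 2))) (g₁ := g₁ (B / 2 * (x 0 ^ 2 + x 1 ^ 2)))
    (g₂ := g₂ (B / 2 * (x 0 ^ 2 + x 1 ^ 2))) hτ hIτ hQ (angSign_mul_natAbs m)
    (ρ := ρ x) (ρ₁ := ρ₁ x) (ρ₂ := ρ₂ x) (by simp only [ρ, radial]; push_cast; ring)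
    (by simp only [ρ₁, radial, G₁]; push_cast; ring)
    (by simp only [ρ₂, radial, G₂, G₁]; push_cast; ring)
  have ho := hode (B / 2 * (x 0 ^ 2 + x 1 ^ 2))
  have ho' : B * (n + 1 - m - 2 * a) * g (B / 2 * (x 0 ^ 2 + x 1 ^ 2))
      - 2 * B * h (B / 2 * (x 0 ^ 2 + x 1 ^ 2)) =
      B * (n + 1 - m) * g (B / 2 * (x 0 ^ 2 + x 1 ^ 2)) - 2 * B * (B / 2 * (x 0 ^ 2 + x 1 ^ 2) *
        g₂ (B / 2 * (x 0 ^ 2 + x 1 ^ 2)) + (n + 1 - B / 2 * (x 0 ^ 2 + x 1 ^ 2)) *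
        g₁ (B / 2 * (x 0 ^ 2 + x 1 ^ 2))) := by
    rw [← ho]
    ring
  have hR : mode B m (fun s => B * (n + 1 - m - 2 * a) * g s - 2 * B * h s) x =
      ζ x ^ n * (Real.exp (-(B / 4) * (x 0 ^ 2 + x 1 ^ 2)) *
        (B * (n + 1 - m) * g (B / 2 * (x 0 ^ 2 + x 1 ^ 2)) - 2 * B * (B / 2 * (x 0 ^ 2 + x 1 ^ 2) *
        g₂ (B / 2 * (x 0 ^ 2 + x 1 ^ 2)) + (n + 1 - B / 2 * (x 0 ^ 2 + x 1 ^ 2)) *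
        g₁ (B / 2 * (x 0 ^ 2 + x 1 ^ 2))))) := by
    rw [mode, radial, ho']
    push_cast
    rfl
  rw [hR, Fin.sum_univ_two]
  refine key.symm.trans ?_
  simp only [F, F', w', w'', angDir, symmPotential, mode]
  simp only [if_true, one_ne_zero, if_false]
  have e3 : ((radial B g (x 0 ^ 2 + x 1 ^ 2) : ℝ) : ℂ) = ρ x := rfl
  have e4 : angCoord m x = ζ x := rfl
  rw [e3, e4, ← hn]
  push_cast
  ring
/-! ### Completeness and orthogonality of the angular modes -/

theorem angCoord_of_nonneg {m : ℤ} (hm : 0 ≤ m) (x : Plane) : angCoord m x = angCoord 0 x := by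
  simp [angCoord, angSign, hm]

theorem angCoord_of_neg {m : ℤ} (hm : m < 0) (x : Plane) :
    angCoord m x = (starRingEnd ℂ) (angCoord 0 x) := by
  simp [angCoord, angSign, hm]

theorem angCoord_zero_mul_conj (x : Plane) :
    angCoord 0 x * (starRingEnd ℂ) (angCoord 0 x) = ((x 0 ^ 2 + x 1 ^ 2 : ℝ) : ℂ) := by
  simp only [angCoord, angSign, le_refl, if_true, map_add, map_mul, Complex.conj_ofReal,
    Complex.conj_I, map_one]
  push_cast
  linear_combination -(x 1 : ℂ) ^ 2 * Complex.I_sq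

/-- In `z^a z̄^b` the common power `min a b` is a power of `|z|²`, and the rest is a pure angular
mode. Conjugation, present because the inner product is conjugate-linear in its first slot, makes
the momentum `b - a`. -/
theorem conj_mode_monomial (B : ℝ) (a b : ℕ) (x : Plane) :
    (starRingEnd ℂ) (mode B ((b : ℤ) - a) (fun s => s ^ min a b) x) =
      angCoord 0 x ^ a * (starRingEnd ℂ) (angCoord 0 x) ^ b *
        ((B / 2) ^ min a b * Real.exp (-(B / 4) * (x 0 ^ 2 + x 1 ^ 2)) : ℝ) := by
  have h := angCoord_zero_mul_conj x
  rw [mode, radial, mul_pow, map_mul, Complex.conj_ofReal, map_pow]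
  push_cast at h ⊢
  rw [← h]
  rcases le_or_gt a b with hab | hab
  · obtain ⟨c, rfl⟩ := Nat.exists_eq_add_of_le hab
    have hc : (((a + c : ℕ) : ℤ) - a) = c := by push_cast; ring
    rw [hc, angCoord_of_nonneg (by positivity), Int.natAbs_natCast, min_eq_left hab]
    ring
  · obtain ⟨c, rfl⟩ := Nat.exists_eq_add_of_le hab.le
    have hc : ((b : ℤ) - ((b + c : ℕ) : ℤ)) = -(c : ℤ) := by push_cast; ring
    rw [hc, angCoord_of_neg (by omega), Int.natAbs_neg, Int.natAbs_natCast, min_eq_right hab.le,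
      Complex.conj_conj]
    ring

/-- A function on a disc that is orthogonal to all polynomials vanishes. -/
theorem ae_eq_zero_of_integral_monomial {r : ℝ} {U : Plane → ℂ}
    (hU : Integrable U (volume.restrict (Metric.ball 0 r)))
    (h : ∀ a b : ℕ, ∫ x in Metric.ball (0 : Plane) r,
      angCoord 0 x ^ a * (starRingEnd ℂ) (angCoord 0 x) ^ b * U x = 0) :
    U =ᵐ[volume.restrict (Metric.ball 0 r)] 0 := by
  have cz := continuous_angCoord 0
  let z : Plane → Fin 2 → ℂ := fun x => ![angCoord 0 x, (starRingEnd ℂ) (angCoord 0 x)]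
  have hint : ∀ F : Plane → ℂ, Continuous F →
      Integrable (fun x => F x * U x) (volume.restrict (Metric.ball 0 r)) := by
    intro F hF
    obtain ⟨C, hC⟩ := exists_bound_on_ball hF r
    refine hU.bdd_mul (c := C) hF.aestronglyMeasurable ?_
    filter_upwards [ae_restrict_mem measurableSet_ball] with x hx using hC x hx
  have cpoly : ∀ P : MvPolynomial (Fin 2) ℂ, Continuous fun x => MvPolynomial.eval (z x) P := by
    intro P
    refine (MvPolynomial.continuous_eval P).comp (continuous_pi fun i => ?_)
    fin_cases i
    · exact cz
    · exact Complex.continuous_conj.comp cz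
  have hpoly : ∀ P : MvPolynomial (Fin 2) ℂ,
      ∫ x in Metric.ball (0 : Plane) r, MvPolynomial.eval (z x) P * U x = 0 := by
    intro P
    have e : ∀ x, MvPolynomial.eval (z x) P * U x = ∑ d ∈ P.support, P.coeff d *
        (angCoord 0 x ^ d 0 * (starRingEnd ℂ) (angCoord 0 x) ^ d 1 * U x) := by
      intro x
      rw [MvPolynomial.eval_eq', Finset.sum_mul]
      refine Finset.sum_congr rfl fun d _ => ?_
      rw [Fin.prod_univ_two]
      simp only [z, Matrix.cons_val_zero, Matrix.cons_val_one]
      ring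
    simp only [e]
    rw [integral_finsetSum]
    · refine Finset.sum_eq_zero fun d _ => ?_
      rw [integral_const_mul, h, mul_zero]
    · intro d _
      refine (hint (fun x => angCoord 0 x ^ d 0 * (starRingEnd ℂ) (angCoord 0 x) ^ d 1) ?_).const_mul _
      exact (cz.pow _).mul ((Complex.continuous_conj.comp cz).pow _)
  -- Stone-Weierstrass on the compact disc: the single function `z` separates points, so polynomials
  -- in `z` and `z̄` are uniformly dense, and integrability of `U` transfers this to the integrals.
  let X := Metric.closedBall (0 : Plane) r
  have : CompactSpace X := isCompact_iff_compactSpace.1 (isCompact_closedBall _ _)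
  let zX : C(X, ℂ) := ⟨fun x => angCoord 0 x, cz.comp continuous_subtype_val⟩
  let S : StarSubalgebra ℂ C(X, ℂ) := StarAlgebra.adjoin ℂ {zX}
  have hS : S.topologicalClosure = ⊤ := by
    refine ContinuousMap.starSubalgebra_topologicalClosure_eq_top_of_separatesPoints S ?_
    intro x y hxy
    refine ⟨zX, ⟨zX, StarAlgebra.self_mem_adjoin_singleton ℂ zX, rfl⟩, fun heq => hxy ?_⟩
    have h1 : angCoord 0 (x : Plane) = angCoord 0 (y : Plane) := heq
    have h2 := congrArg Complex.re h1
    have h3 := congrArg Complex.im h1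
    simp [angCoord, angSign] at h2 h3
    ext j
    fin_cases j
    · exact h2
    · exact h3
  have hadj : ∀ q ∈ S, ∃ P : MvPolynomial (Fin 2) ℂ, ∀ x : X, q x = MvPolynomial.eval (z x) P := by
    intro q hq
    induction hq using StarAlgebra.adjoin_induction with
    | mem q hq =>
      rw [Set.mem_singleton_iff] at hq
      subst hq
      exact ⟨MvPolynomial.X 0, fun x => by simp [z, zX]⟩
    | algebraMap c => exact ⟨MvPolynomial.C c, fun x => by simp⟩
    | add q₁ q₂ _ _ h₁ h₂ =>
      obtain ⟨P₁, h₁⟩ := h₁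
      obtain ⟨P₂, h₂⟩ := h₂
      exact ⟨P₁ + P₂, fun x => by rw [ContinuousMap.add_apply, h₁, h₂, map_add]⟩
    | mul q₁ q₂ _ _ h₁ h₂ =>
      obtain ⟨P₁, h₁⟩ := h₁
      obtain ⟨P₂, h₂⟩ := h₂
      exact ⟨P₁ * P₂, fun x => by rw [ContinuousMap.mul_apply, h₁, h₂, map_mul]⟩
    | star q _ hq =>
      obtain ⟨P, hP⟩ := hq
      -- Conjugating a polynomial in `z, z̄` conjugates its coefficients and exchanges the two
      -- variables.
      refine ⟨MvPolynomial.rename (Equiv.swap 0 1) (MvPolynomial.map (starRingEnd ℂ) P), fun x => ?_⟩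
      rw [ContinuousMap.star_apply, hP, MvPolynomial.eval_rename, MvPolynomial.eval_map]
      have hz : z x ∘ (Equiv.swap 0 1) = fun i => (starRingEnd ℂ) (z x i) := by
        funext i
        fin_cases i <;> simp [z]
      rw [hz, ← starRingEnd_apply, ← MvPolynomial.eval₂_id, MvPolynomial.hom_eval₂]
      rfl
  have hcont : ∀ F : Plane → ℂ, Continuous F →
      ∫ x in Metric.ball (0 : Plane) r, F x * U x = 0 := by
    intro F hF
    set M := ∫ x in Metric.ball (0 : Plane) r, ‖U x‖ with hM
    have hM0 : 0 ≤ M := integral_nonneg fun x => norm_nonneg _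
    have hle : ∀ ε > 0, ‖∫ x in Metric.ball (0 : Plane) r, F x * U x‖ ≤ ε * M := by
      intro ε hε
      let FX : C(X, ℂ) := ⟨fun x => F x, hF.comp continuous_subtype_val⟩
      have hmem : FX ∈ closure (S : Set C(X, ℂ)) := by
        rw [← StarSubalgebra.topologicalClosure_coe, hS]
        trivial
      obtain ⟨q, hq, hd⟩ := Metric.mem_closure_iff.1 hmem ε hε
      obtain ⟨P, hP⟩ := hadj q hq
      rw [ContinuousMap.dist_lt_iff hε] at hd
      have e : ∫ x in Metric.ball (0 : Plane) r, F x * U x =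
          ∫ x in Metric.ball (0 : Plane) r, (F x - MvPolynomial.eval (z x) P) * U x := by
        simp only [sub_mul]
        rw [integral_sub (hint F hF) (hint _ (cpoly P)), hpoly, sub_zero]
      rw [e, hM, ← integral_const_mul]
      refine norm_integral_le_of_norm_le (hU.norm.const_mul ε) ?_
      filter_upwards [ae_restrict_mem measurableSet_ball] with x hx
      rw [norm_mul]
      refine mul_le_mul_of_nonneg_right ?_ (norm_nonneg _)
      have := hd ⟨x, Metric.ball_subset_closedBall hx⟩
      rw [hP, dist_eq_norm] at this
      exact this.le
    rw [← norm_le_zero_iff]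
    refine le_of_forall_pos_le_add fun ε hε => ?_
    refine (hle (ε / (M + 1)) (by positivity)).trans ?_
    rw [zero_add, div_mul_eq_mul_div, div_le_iff₀ (by positivity)]
    nlinarith
  have hloc : LocallyIntegrableOn U (Metric.ball 0 r) volume :=
    IntegrableOn.locallyIntegrableOn hU
  have hz := Metric.isOpen_ball.ae_eq_zero_of_integral_contDiff_smul_eq_zero hloc fun g hg cg sg => by
    rw [← hcont (fun x => (g x : ℂ)) (Complex.continuous_ofReal.comp hg.continuous),
      setIntegral_eq_integral_of_forall_compl_eq_zero]
    · rfl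
    · intro x hx
      rw [image_eq_zero_of_notMem_tsupport (fun h => hx (sg h)), Complex.ofReal_zero, zero_mul]
  exact (ae_restrict_iff' measurableSet_ball).2 hz

/-- The modes with monomial radial factors are total in `L²` of the disc. -/
theorem IsGauge.eq_zero_of_inner_mode {B r : ℝ} (hB : B ≠ 0) {A : Plane → Plane} {E : Plane → ℂ}
    (hE : IsGauge B r A E) {u : L2 (Metric.ball (0 : Plane) r)}
    (h : ∀ (m : ℤ) (p : ℕ), inner ℂ (hE.toL2 (continuous_mode B m (continuous_pow p))) u = 0) :
    u = 0 := by
  let e : Plane → ℂ := fun x => (Real.exp (-(B / 4) * (x 0 ^ 2 + x 1 ^ 2)) : ℝ)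
  have ce : Continuous e := by fun_prop
  have hmem := hE.memLp ce
  -- The nowhere vanishing gauge factor and Gaussian are absorbed into `U`, so that the hypotheses
  -- become orthogonality to the monomials `z^a z̄^b`.
  let U : Plane → ℂ := fun x => (starRingEnd ℂ) (E x * e x) * u x
  have hU : Integrable U (volume.restrict (Metric.ball 0 r)) := by
    obtain ⟨C, hC⟩ := exists_bound_on_ball ce r
    refine Integrable.bdd_mul (c := C) ((Lp.memLp u).integrable (by norm_num))
      (Complex.continuous_conj.comp_aestronglyMeasurable hmem.1) ?_
    filter_upwards [ae_restrict_mem measurableSet_ball] with x hx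
    rw [RCLike.norm_conj, norm_mul, hE.norm_eq x hx, one_mul]
    exact hC x hx
  have hz := ae_eq_zero_of_integral_monomial hU fun a b => by
    have h1 := h ((b : ℤ) - a) (min a b)
    rw [L2.inner_def] at h1
    have h2 : ∫ x in Metric.ball (0 : Plane) r, ((B / 2 : ℂ) ^ min a b) *
        (angCoord 0 x ^ a * (starRingEnd ℂ) (angCoord 0 x) ^ b * U x) = 0 := by
      rw [← h1]
      refine integral_congr_ae ?_
      filter_upwards [hE.coeFn_toL2 (continuous_mode B ((b : ℤ) - a) (continuous_pow (min a b)))]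
        with x hx
      rw [hx, RCLike.inner_apply, map_mul, conj_mode_monomial]
      simp only [U, e, map_mul, Complex.conj_ofReal]
      push_cast
      ring
    rw [integral_const_mul] at h2
    refine (mul_eq_zero.1 h2).resolve_left (pow_ne_zero _ ?_)
    simpa using hB
  rw [Lp.eq_zero_iff_ae_eq_zero]
  filter_upwards [hz, ae_restrict_mem measurableSet_ball] with x hx hxr
  have hE0 : E x ≠ 0 := fun h0 => by simpa [h0] using hE.norm_eq x hxr
  have he0 : e x ≠ 0 := Complex.ofReal_ne_zero.2 (Real.exp_pos _).ne'
  have : (starRingEnd ℂ) (E x * e x) ≠ 0 :=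
    (map_ne_zero _).2 (mul_ne_zero hE0 he0)
  exact (mul_eq_zero.1 hx).resolve_left this

/-- The rotation of the plane by an element of the unit circle. -/
def planeRotation (c : Circle) : Plane ≃ₗᵢ[ℝ] Plane :=
  (Complex.orthonormalBasisOneI.repr.symm.trans (rotation c)).trans
    Complex.orthonormalBasisOneI.repr

theorem angCoord_zero_planeRotation (c : Circle) (x : Plane) :
    angCoord 0 (planeRotation c x) = c * angCoord 0 x := by
  have h : ∀ y : Plane, angCoord 0 y = Complex.orthonormalBasisOneI.repr.symm y := fun y => by
    rw [Complex.orthonormalBasisOneI_repr_symm_apply]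
    simp [angCoord, angSign, mul_comm]
  rw [h, h, planeRotation]
  simp only [LinearIsometryEquiv.trans_apply, LinearIsometryEquiv.symm_apply_apply, rotation_apply]

theorem sq_add_sq_planeRotation (c : Circle) (x : Plane) :
    planeRotation c x 0 ^ 2 + planeRotation c x 1 ^ 2 = x 0 ^ 2 + x 1 ^ 2 := by
  have h : ∀ y : Plane, y 0 ^ 2 + y 1 ^ 2 = ‖y‖ ^ 2 := fun y => by
    rw [EuclideanSpace.norm_sq_eq, Fin.sum_univ_two, Real.norm_eq_abs, Real.norm_eq_abs, sq_abs,
      sq_abs]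
  rw [h, h, LinearIsometryEquiv.norm_map]

/-- The `m`-th mode transforms under rotations by the character `c ^ m`; this is what separates
different momenta. -/
theorem mode_planeRotation (B : ℝ) (m : ℤ) (g : ℝ → ℝ) (c : Circle) (x : Plane) :
    mode B m g (planeRotation c x) = (c : ℂ) ^ m * mode B m g x := by
  rw [mode, mode, sq_add_sq_planeRotation, ← mul_assoc]
  congr 1
  rcases le_or_gt 0 m with hm | hm
  · obtain ⟨n, rfl⟩ := Int.eq_ofNat_of_zero_le hm
    rw [angCoord_of_nonneg hm, angCoord_of_nonneg hm, angCoord_zero_planeRotation, Int.natAbs_natCast,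
      mul_pow, zpow_natCast]
  · obtain ⟨n, hn⟩ := Int.exists_eq_neg_ofNat hm.le
    rw [angCoord_of_neg hm, angCoord_of_neg hm, angCoord_zero_planeRotation, hn, Int.natAbs_neg,
      Int.natAbs_natCast, map_mul, mul_pow, zpow_neg, zpow_natCast, ← Circle.coe_inv_eq_conj,
      Circle.coe_inv, inv_pow]

/-- Rotation preserves the disc and Lebesgue measure, so the integral equals `d` times itself. -/
theorem integral_ball_eq_zero_of_rotation {r : ℝ} {f : Plane → ℂ} {c : Circle} {d : ℂ} (hd : d ≠ 1)
    (hf : ∀ x, f (planeRotation c x) = d * f x) :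
    ∫ x in Metric.ball (0 : Plane) r, f x = 0 := by
  have h := (planeRotation c).measurePreserving.setIntegral_preimage_emb
    (planeRotation c).toHomeomorph.measurableEmbedding f (Metric.ball 0 r)
  have hpre : planeRotation c ⁻¹' Metric.ball 0 r = Metric.ball 0 r := by
    ext x
    simp
  rw [hpre] at h
  simp only [hf, integral_const_mul] at h
  have h2 : (d - 1) * ∫ x in Metric.ball (0 : Plane) r, f x = 0 := by linear_combination h
  exact (mul_eq_zero.1 h2).resolve_left (sub_ne_zero.2 hd)

theorem exists_circle_zpow_ne_one {k : ℤ} (hk : k ≠ 0) : ∃ c : Circle, (c : ℂ) ^ k ≠ 1 := by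
  refine ⟨Circle.exp (Real.pi / k), ?_⟩
  rw [Circle.coe_exp, ← Complex.exp_int_mul]
  have : (k : ℂ) * ((Real.pi / k : ℝ) * Complex.I) = Real.pi * Complex.I := by
    have : (k : ℂ) ≠ 0 := by exact_mod_cast hk
    push_cast
    field_simp
  rw [this, Complex.exp_pi_mul_I]
  norm_num

/-- Modes of different angular momentum are orthogonal. -/
theorem IsGauge.inner_mode_eq_zero {B r : ℝ} {A : Plane → Plane} {E : Plane → ℂ}
    (hE : IsGauge B r A E) {m m' : ℤ} (hm : m ≠ m') {g g' : ℝ → ℝ} (cg : Continuous g)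
    (cg' : Continuous g') :
    inner ℂ (hE.toL2 (continuous_mode B m cg)) (hE.toL2 (continuous_mode B m' cg')) = 0 := by
  obtain ⟨c, hc⟩ := exists_circle_zpow_ne_one (sub_ne_zero.2 hm.symm)
  rw [L2.inner_def]
  have h := integral_ball_eq_zero_of_rotation (r := r) hc
    (f := fun x => (starRingEnd ℂ) (mode B m g x) * mode B m' g' x) fun x => by
    have h0 : (c : ℂ) ≠ 0 := c.coe_ne_zero
    rw [mode_planeRotation, mode_planeRotation, map_mul, map_zpow₀, ← Circle.coe_inv_eq_conj,
      Circle.coe_inv, inv_zpow, zpow_sub₀ h0]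
    field_simp
  rw [← h]
  refine integral_congr_ae ?_
  filter_upwards [hE.coeFn_toL2 (continuous_mode B m cg), hE.coeFn_toL2 (continuous_mode B m' cg'),
    ae_restrict_mem measurableSet_ball] with x h1 h2 hx
  rw [h1, h2, RCLike.inner_apply, map_mul]
  -- The gauge factor need not be compatible with rotations, but it cancels pointwise, being
  -- unimodular.
  have h3 : (starRingEnd ℂ) (E x) * E x = 1 := by
    rw [Complex.conj_mul', hE.norm_eq x hx]
    norm_num
  linear_combination (starRingEnd ℂ) (mode B m g x) * mode B m' g' x * h3

/-- A continuous mode vanishing almost everywhere vanishes on the disc. On the positive first axis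
its prefactors are nonzero, so `g` vanishes there, and letting the point tend to the centre gives `g
0 = 0`. -/
theorem IsGauge.toL2_mode_ne_zero {B r : ℝ} (hr : 0 < r) {A : Plane → Plane} {E : Plane → ℂ}
    (hE : IsGauge B r A E) (m : ℤ) {g : ℝ → ℝ} (cg : Continuous g) (h0 : g 0 ≠ 0) :
    hE.toL2 (continuous_mode B m cg) ≠ 0 := by
  intro hcon
  rw [Lp.eq_zero_iff_ae_eq_zero] at hcon
  have hae : mode B m g =ᵐ[volume.restrict (Metric.ball 0 r)] fun _ => 0 := by
    filter_upwards [hcon, hE.coeFn_toL2 (continuous_mode B m cg),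
      ae_restrict_mem measurableSet_ball] with x h1 h2 hx
    rw [h2] at h1
    refine (mul_eq_zero.1 h1).resolve_left fun hEx => ?_
    simpa [hEx] using hE.norm_eq x hx
  have hz := Measure.eqOn_open_of_ae_eq hae Metric.isOpen_ball
    (continuous_mode B m cg).continuousOn continuousOn_const
  have hgz : ∀ ε ∈ Set.Ioo 0 r, g (B / 2 * ε ^ 2) = 0 := by
    intro ε hε
    have h1 := hz (x := EuclideanSpace.single 0 ε) (by
      rw [mem_ball_zero_iff, PiLp.norm_single, Real.norm_of_nonneg hε.1.le]
      exact hε.2)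
    simpa [mode, angCoord, radial, hε.1.ne'] using h1
  have ht : Tendsto (fun ε : ℝ => g (B / 2 * ε ^ 2)) (𝓝[>] 0) (𝓝 (g 0)) := by
    have : Continuous fun ε : ℝ => g (B / 2 * ε ^ 2) := by fun_prop
    have h2 := (this.tendsto 0).mono_left (nhdsWithin_le_nhds (s := Set.Ioi 0))
    simpa using h2
  refine h0 (tendsto_nhds_unique ht (tendsto_const_nhds.congr' ?_))
  filter_upwards [Ioo_mem_nhdsGT hr] with ε hε using (hgz ε hε).symm
/-! ### The spectrum -/

theorem mem_eigenspace_iff {Ω : Set Plane} (hΩ : IsOpen Ω) {A : Plane → Plane} (hA : Continuous A)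
    {μ : ℂ} {u : L2 Ω} :
    u ∈ eigenspace (magneticDirichletLaplacian Ω A) μ ↔
      (u, μ • u) ∈ magneticDirichletGraph Ω A := by
  have hgr : (magneticDirichletLaplacian Ω A).graph = magneticDirichletGraph Ω A :=
    Submodule.toLinearPMap_graph_eq _ (magneticDirichletGraph_single_valued hΩ hA)
  rw [← hgr, LinearPMap.mem_graph_iff]
  constructor
  · rintro ⟨hu, h⟩
    exact ⟨⟨u, hu⟩, rfl, h⟩
  · rintro ⟨⟨v, hv⟩, hvu, h⟩
    obtain rfl : v = u := hvu
    exact ⟨hv, h⟩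

theorem isEigenvalue_iff_eigenspace_ne_bot {F : Type*} [AddCommGroup F] [Module ℂ F]
    {H : F →ₗ.[ℂ] F} {μ : ℂ} : IsEigenvalue H μ ↔ eigenspace H μ ≠ ⊥ := by
  rw [Submodule.ne_bot_iff]
  constructor
  · rintro ⟨u, hu, h⟩
    exact ⟨u, ⟨u.2, h⟩, fun h0 => hu (Subtype.ext h0)⟩
  · rintro ⟨u, ⟨hu, h⟩, h0⟩
    exact ⟨⟨u, hu⟩, fun h1 => h0 (congrArg Subtype.val h1), h⟩

/-- The magnetic Dirichlet Laplacian is symmetric. -/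
theorem inner_symm_of_mem_graph {Ω : Set Plane} {A : Plane → Plane} {p q : L2 Ω × L2 Ω}
    (hp : p ∈ magneticDirichletGraph Ω A) (hq : q ∈ magneticDirichletGraph Ω A) :
    inner ℂ q.1 p.2 = inner ℂ q.2 p.1 := by
  obtain ⟨G, hG, e⟩ := hp
  obtain ⟨K, hK, e'⟩ := hq
  rw [← e _ hK, ← inner_conj_symm q.2 p.1, ← e' _ hG, map_sum]
  exact Finset.sum_congr rfl fun j _ => (inner_conj_symm _ _).symm

/-- Eigenvalues of a symmetric operator are real. -/
theorem conj_eq_of_mem_graph {Ω : Set Plane} {A : Plane → Plane} {μ : ℂ} {u : L2 Ω}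
    (hu : (u, μ • u) ∈ magneticDirichletGraph Ω A) (h0 : u ≠ 0) : (starRingEnd ℂ) μ = μ := by
  have h := inner_symm_of_mem_graph hu hu
  simp only [inner_smul_left, inner_smul_right] at h
  exact (mul_right_cancel₀ (inner_self_ne_zero.2 h0) h).symm

theorem IsGauge.toL2_mode_comb {B r : ℝ} {A : Plane → Plane} {E : Plane → ℂ} (hE : IsGauge B r A E)
    (m : ℤ) {g h : ℝ → ℝ} (cg : Continuous g) (ch : Continuous h) (c d : ℝ)
    (cs : Continuous fun s => c * g s + d * h s) :
    hE.toL2 (continuous_mode B m cs) =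
      (c : ℂ) • hE.toL2 (continuous_mode B m cg) + (d : ℂ) • hE.toL2 (continuous_mode B m ch) := by
  refine Lp.ext ?_
  filter_upwards [hE.coeFn_toL2 (continuous_mode B m cs), hE.coeFn_toL2 (continuous_mode B m cg),
    hE.coeFn_toL2 (continuous_mode B m ch),
    Lp.coeFn_add ((c : ℂ) • hE.toL2 (continuous_mode B m cg))
      ((d : ℂ) • hE.toL2 (continuous_mode B m ch)),
    Lp.coeFn_smul (c : ℂ) (hE.toL2 (continuous_mode B m cg)),
    Lp.coeFn_smul (d : ℂ) (hE.toL2 (continuous_mode B m ch))] with x h1 h2 h3 h4 h5 h6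
  rw [h4, Pi.add_apply, h5, h6, Pi.smul_apply, Pi.smul_apply, h1, h2, h3]
  simp only [mode, radial, smul_eq_mul]
  push_cast
  ring

/-- The parameter `a` for which the angular mode `m` has eigenvalue `μ`. -/
def modeParam (B μ : ℝ) (m : ℤ) : ℝ := (m.natAbs + 1 - m - μ / B) / 2

theorem modeParam_spec {B : ℝ} (hB : B ≠ 0) (μ : ℝ) (m : ℤ) :
    B * (m.natAbs + 1 - m - 2 * modeParam B μ m) = μ := by
  rw [modeParam]
  field_simp
  ring

section Eigenspace

variable {B r : ℝ} {A : Plane → Plane} {E : Plane → ℂ}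

/-- An eigenfunction is orthogonal to the range of the Kummer operator. -/
theorem IsGauge.inner_mode_eq_zero_of_solvesKummer (hB : B ≠ 0) (hr : 0 < r) (hA : Continuous A)
    (hE : IsGauge B r A E) {μ : ℝ} {u : L2 (Metric.ball (0 : Plane) r)}
    (hu : (u, (μ : ℂ) • u) ∈ magneticDirichletGraph (Metric.ball 0 r) A) {m : ℤ} {g h : ℝ → ℝ}
    (hg : SolvesKummer (modeParam B μ m) (m.natAbs + 1) g h) (h0 : g (B / 2 * r ^ 2) = 0)
    (ch : Continuous h) : inner ℂ (hE.toL2 (continuous_mode B m ch)) u = 0 := by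
  have cg : Continuous g := by
    obtain ⟨g₁, _, hg1, _⟩ := hg
    exact continuous_iff_continuousAt.2 fun s => (hg1 s).continuousAt
  have hmem := hE.mode_mem_graph hr hA m hg h0 cg (by fun_prop)
  have e : (fun s => B * (m.natAbs + 1 - m - 2 * modeParam B μ m) * g s - 2 * B * h s) =
      fun s => μ * g s + (-2 * B) * h s := by
    funext s
    rw [modeParam_spec hB]
    ring
  simp only [e] at hmem
  rw [hE.toL2_mode_comb m cg ch μ (-2 * B) (by fun_prop)] at hmem
  -- The operator sends the mode of `g` to `μ` times itself minus `2B` times the mode of `h`.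
  -- Pairing with `u`, the `μ` terms cancel by symmetry.
  have hs := inner_symm_of_mem_graph hu hmem
  simp only [inner_smul_right, inner_add_left, inner_smul_left, Complex.conj_ofReal] at hs
  have h1 : ((-2 * B : ℝ) : ℂ) * inner ℂ (hE.toL2 (continuous_mode B m ch)) u = 0 := by
    linear_combination -hs
  refine (mul_eq_zero.1 h1).resolve_left ?_
  exact_mod_cast mul_ne_zero (by norm_num) hB

theorem natAbs_add_one_pos (m : ℤ) : (0 : ℝ) < (m.natAbs : ℝ) + 1 := by positivity

/-- Off resonance every monomial is the image of a function vanishing at the boundary: a multiple of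
`M` corrects the particular solution. -/
theorem IsGauge.inner_mode_pow_eq_zero (hB : B ≠ 0) (hr : 0 < r) (hA : Continuous A)
    (hE : IsGauge B r A E) {μ : ℝ} {u : L2 (Metric.ball (0 : Plane) r)}
    (hu : (u, (μ : ℂ) • u) ∈ magneticDirichletGraph (Metric.ball 0 r) A) {m : ℤ}
    (hm : kummerM (modeParam B μ m) (m.natAbs + 1) (B / 2 * r ^ 2) ≠ 0) (p : ℕ) :
    inner ℂ (hE.toL2 (continuous_mode B m (continuous_pow p))) u = 0 := by
  obtain ⟨g, hg⟩ := exists_solvesKummer_pow (modeParam B μ m) (natAbs_add_one_pos m) p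
  have hM := solvesKummer_kummerM (modeParam B μ m) (natAbs_add_one_pos m)
  have h := hg.linear_comb hM 1 (-(g (B / 2 * r ^ 2) /
    kummerM (modeParam B μ m) (m.natAbs + 1) (B / 2 * r ^ 2)))
  simp only [one_mul, Pi.zero_apply, mul_zero, add_zero] at h
  refine hE.inner_mode_eq_zero_of_solvesKummer hB hr hA hu h ?_ (continuous_pow p)
  rw [neg_mul, div_mul_cancel₀ _ hm, add_neg_cancel]

/-- The component of an eigenfunction in an angular mode is determined by one number. -/
theorem IsGauge.exists_pow_determines_mode (hB : B ≠ 0) (hr : 0 < r) (hA : Continuous A)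
    (hE : IsGauge B r A E) (μ : ℝ) (m : ℤ) : ∃ q : ℕ, ∀ u : L2 (Metric.ball (0 : Plane) r),
      (u, (μ : ℂ) • u) ∈ magneticDirichletGraph (Metric.ball 0 r) A →
      inner ℂ (hE.toL2 (continuous_mode B m (continuous_pow q))) u = 0 →
      ∀ p : ℕ, inner ℂ (hE.toL2 (continuous_mode B m (continuous_pow p))) u = 0 := by
  choose g hg using exists_solvesKummer_pow (modeParam B μ m) (natAbs_add_one_pos m)
  -- A particular solution `g q` with nonzero boundary value serves to correct all the others. If
  -- none exists, every moment vanishes already and the index `0` is arbitrary.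
  by_cases hq : ∃ q, g q (B / 2 * r ^ 2) ≠ 0
  · obtain ⟨q, hq⟩ := hq
    refine ⟨q, fun u hu hu0 p => ?_⟩
    have h := (hg p).linear_comb (hg q) (g q (B / 2 * r ^ 2)) (-g p (B / 2 * r ^ 2))
    have h1 := hE.inner_mode_eq_zero_of_solvesKummer hB hr hA hu h (by ring) (by fun_prop)
    rw [hE.toL2_mode_comb m (continuous_pow p) (continuous_pow q) _ _ (by fun_prop),
      inner_add_left, inner_smul_left, inner_smul_left, hu0, mul_zero, add_zero] at h1
    refine (mul_eq_zero.1 h1).resolve_left ?_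
    rw [Complex.conj_ofReal]
    exact_mod_cast hq
  · push Not at hq
    exact ⟨0, fun u hu _ p =>
      hE.inner_mode_eq_zero_of_solvesKummer hB hr hA hu (hg p) (hq p) (continuous_pow p)⟩

theorem continuous_kummerM (a : ℝ) (m : ℤ) : Continuous (kummerM a (m.natAbs + 1)) := by
  obtain ⟨g₁, _, hg1, _⟩ := solvesKummer_kummerM a (natAbs_add_one_pos m)
  exact continuous_iff_continuousAt.2 fun s => (hg1 s).continuousAt

/-- The explicit eigenfunctions. -/
theorem IsGauge.kummer_mode_mem_graph (hB : B ≠ 0) (hr : 0 < r) (hA : Continuous A)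
    (hE : IsGauge B r A E) {μ : ℝ} {m : ℤ}
    (hm : kummerM (modeParam B μ m) (m.natAbs + 1) (B / 2 * r ^ 2) = 0) :
    (hE.toL2 (continuous_mode B m (continuous_kummerM (modeParam B μ m) m)),
      (μ : ℂ) • hE.toL2 (continuous_mode B m (continuous_kummerM (modeParam B μ m) m))) ∈
      magneticDirichletGraph (Metric.ball 0 r) A := by
  have cM := continuous_kummerM (modeParam B μ m) m
  have hmem := hE.mode_mem_graph hr hA m
    (solvesKummer_kummerM (modeParam B μ m) (natAbs_add_one_pos m)) hm cM
    (by simp only [Pi.zero_apply]; fun_prop)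
  have e : (fun s => B * (m.natAbs + 1 - m - 2 * modeParam B μ m) *
      kummerM (modeParam B μ m) (m.natAbs + 1) s - 2 * B * (0 : ℝ → ℝ) s) =
      fun s => μ * kummerM (modeParam B μ m) (m.natAbs + 1) s +
        0 * kummerM (modeParam B μ m) (m.natAbs + 1) s := by
    funext s
    rw [modeParam_spec hB, Pi.zero_apply]
    ring
  simp only [e] at hmem
  rw [hE.toL2_mode_comb m cM cM μ 0 (by fun_prop), Complex.ofReal_zero, zero_smul, add_zero] at hmem
  exact hmem

/-- The angular momenta that contribute to the eigenvalue `μ`. -/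
def resonantModes (B r μ : ℝ) : Set ℤ :=
  {m | kummerM (modeParam B μ m) (m.natAbs + 1) (B / 2 * r ^ 2) = 0}

/-- For `m ≥ 0` the parameter `a` does not depend on `m`, and `M(a, m + 1, x) → 1` excludes large
`m`. For very negative `m` the parameter is nonnegative, so `M ≥ 1`. -/
theorem finite_resonantModes (hB : 0 < B) (r μ : ℝ) : (resonantModes B r μ).Finite := by
  have hx : 0 ≤ B / 2 * r ^ 2 := by positivity
  have h1 := (tendsto_kummerM_nat ((1 - μ / B) / 2) (B / 2 * r ^ 2)).eventually_ne one_ne_zero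
  obtain ⟨N, hN⟩ := eventually_atTop.1 h1
  obtain ⟨K, hK⟩ := exists_nat_ge (μ / B)
  refine (Set.finite_Icc (-(K : ℤ)) N).subset fun m hm => ?_
  rw [resonantModes, Set.mem_ofPred_eq, modeParam] at hm
  constructor
  · by_contra! hlt
    have h0 : (m.natAbs : ℝ) = -m := by
      rw [Nat.cast_natAbs, Int.cast_abs, abs_of_neg]
      exact_mod_cast (by omega : m < 0)
    have h2 : (m : ℝ) ≤ -K := by exact_mod_cast hlt.le
    have h3 : 0 ≤ (m.natAbs + 1 - m - μ / B) / 2 := by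
      rw [h0]
      have : (0 : ℝ) ≤ K := by positivity
      linarith
    linarith [one_le_kummerM h3 (natAbs_add_one_pos m) hx]
  · by_contra! hlt
    obtain ⟨n, rfl⟩ := Int.eq_ofNat_of_zero_le (show 0 ≤ m by omega)
    refine hN n (by omega) ?_
    rw [← hm, Int.natAbs_natCast]
    congr 1
    push_cast
    ring

/-- One moment per resonant `m` embeds the eigenspace linearly into a finite coordinate space; the
Kummer modes are as many independent eigenfunctions. -/
theorem IsGauge.rank_eigenspace (hB : 0 < B) (hr : 0 < r) (hA : Continuous A)
    (hE : IsGauge B r A E) (μ : ℝ) :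
    Module.rank ℂ (eigenspace (magneticDirichletLaplacian (Metric.ball 0 r) A) (μ : ℂ)) =
      Cardinal.mk (resonantModes B r μ) := by
  have : Fintype (resonantModes B r μ) := (finite_resonantModes hB r μ).fintype
  have hiff : ∀ u, u ∈ eigenspace (magneticDirichletLaplacian (Metric.ball 0 r) A) (μ : ℂ) ↔ _ :=
    fun u => mem_eigenspace_iff Metric.isOpen_ball hA
  refine le_antisymm ?_ ?_
  · choose q hq using hE.exists_pow_determines_mode hB.ne' hr hA μ
    let T : eigenspace (magneticDirichletLaplacian (Metric.ball 0 r) A) (μ : ℂ) →ₗ[ℂ]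
        (resonantModes B r μ → ℂ) := LinearMap.pi fun m =>
      (innerSL ℂ (hE.toL2 (continuous_mode B (m : ℤ) (continuous_pow (q m))))).toLinearMap ∘ₗ
        Submodule.subtype _
    have hT : Function.Injective T := by
      rw [← LinearMap.ker_eq_bot, LinearMap.ker_eq_bot']
      rintro ⟨u, hu⟩ h
      have hu' := (hiff u).1 hu
      refine Subtype.ext (hE.eq_zero_of_inner_mode hB.ne' fun m p => ?_)
      by_cases hm : m ∈ resonantModes B r μ
      · exact hq m u hu' (congrFun h ⟨m, hm⟩) p
      · exact hE.inner_mode_pow_eq_zero hB.ne' hr hA hu' hm p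
    refine (LinearMap.rank_le_of_injective T hT).trans ?_
    rw [rank_fun', Cardinal.mk_fintype]
  · let v : resonantModes B r μ → L2 (Metric.ball (0 : Plane) r) := fun m =>
      hE.toL2 (continuous_mode B m (continuous_kummerM (modeParam B μ m) m))
    have hv : LinearIndependent ℂ v := by
      refine linearIndependent_of_ne_zero_of_inner_eq_zero (fun m => ?_) fun m m' hm => ?_
      · refine hE.toL2_mode_ne_zero hr m (continuous_kummerM (modeParam B μ m) m) ?_
        rw [kummerM_apply_zero _ (natAbs_add_one_pos m)]
        exact one_ne_zero
      · exact hE.inner_mode_eq_zero (fun h => hm (Subtype.ext h))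
          (continuous_kummerM (modeParam B μ m) m) (continuous_kummerM (modeParam B μ m') m')
    have hmem : ∀ m, v m ∈ eigenspace (magneticDirichletLaplacian (Metric.ball 0 r) A) (μ : ℂ) :=
      fun m => (hiff _).2 (hE.kummer_mode_mem_graph hB.ne' hr hA m.2)
    have hw : LinearIndependent ℂ fun m => (⟨v m, hmem m⟩ :
        eigenspace (magneticDirichletLaplacian (Metric.ball 0 r) A) (μ : ℂ)) :=
      LinearIndependent.of_comp (Submodule.subtype _) hv
    exact hw.cardinal_le_rank

end Eigenspace

/-! ### Counting the pairs `(m, k)` and the main theorem -/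

theorem discEigenvalue_eq_iff {B r : ℝ} (hB : 0 < B) (μ : ℝ) (m : ℤ) (k : ℕ) :
    discEigenvalue B r m k = μ ↔ kummerZero m.natAbs (√B * r / √2) k = modeParam B μ m := by
  have h : |(m : ℝ)| = m.natAbs := by rw [Nat.cast_natAbs, Int.cast_abs]
  rw [discEigenvalue, modeParam, h, eq_div_iff (by norm_num : (2 : ℝ) ≠ 0)]
  constructor
  · rintro rfl
    field_simp
    ring
  · intro h
    have h2 : μ = B * (μ / B) := by field_simp
    rw [h2]
    linear_combination (-B) * h

theorem sq_alpha {B r : ℝ} (hB : 0 < B) : (√B * r / √2) ^ 2 = B / 2 * r ^ 2 := by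
  rw [div_pow, mul_pow, Real.sq_sqrt hB.le, Real.sq_sqrt (by norm_num)]
  ring

/-- The projection `(m, k) ↦ m` is a bijection: `m` and `μ` fix the parameter `a`, and the
enumeration of zeros takes each of its values once. -/
theorem mk_pairs_eq_mk_resonantModes {B r : ℝ} (hB : 0 < B) (hr : 0 < r) (μ : ℝ) :
    Cardinal.mk {p : ℤ × ℕ // (discEigenvalue B r p.1 p.2 : ℂ) = μ} =
      Cardinal.mk (resonantModes B r μ) := by
  have hα : √B * r / √2 ≠ 0 := by positivity
  have hiff : ∀ p : ℤ × ℕ, (discEigenvalue B r p.1 p.2 : ℂ) = μ ↔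
      kummerZero p.1.natAbs (√B * r / √2) p.2 = modeParam B μ p.1 := fun p => by
    rw [Complex.ofReal_inj, discEigenvalue_eq_iff hB]
  have hmem : ∀ p : ℤ × ℕ, (discEigenvalue B r p.1 p.2 : ℂ) = μ → p.1 ∈ resonantModes B r μ := by
    intro p hp
    rw [resonantModes, Set.mem_ofPred_eq, ← (hiff p).1 hp, ← sq_alpha hB]
    exact kummerM_kummerZero _ hα _
  refine Cardinal.mk_congr (Equiv.ofBijective (fun p => ⟨p.1.1, hmem p.1 p.2⟩) ⟨?_, ?_⟩)
  · rintro ⟨⟨m, k⟩, hp⟩ ⟨⟨m', k'⟩, hp'⟩ h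
    obtain rfl : m = m' := congrArg Subtype.val h
    have h1 := (hiff _).1 hp
    have h2 := (hiff _).1 hp'
    have := (strictAnti_kummerZero m.natAbs hα).injective (h1.trans h2.symm)
    subst this
    rfl
  · rintro ⟨m, hm⟩
    have h1 : modeParam B μ m ∈ Set.range (kummerZero m.natAbs (√B * r / √2)) := by
      rw [range_kummerZero _ hα, sq_alpha hB]
      exact hm
    obtain ⟨k, hk⟩ := h1
    exact ⟨⟨(m, k), (hiff (m, k)).2 hk⟩, rfl⟩
end MagneticDisc

end

open MagneticDisc
theorem mainTheorem8 (B₀ r₀ : ℝ) (hB₀ : 0 < B₀) (hr₀ : 0 < r₀)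
    (A : Plane → Plane) (hA : ContDiff ℝ 1 A)
    (hcurl : ∀ x ∈ Metric.ball (0 : Plane) r₀, magneticField A x = B₀) :
    (∀ n : ℕ, StrictAnti (kummerZero n (√B₀ * r₀ / √2)) ∧
      Set.range (kummerZero n (√B₀ * r₀ / √2)) =
        {a : ℝ | kummerM a (n + 1) (B₀ * r₀ ^ 2 / 2) = 0} ∧
      ∀ k, kummerZero n (√B₀ * r₀ / √2) k < 0) ∧
    {μ : ℂ | IsEigenvalue (magneticDirichletLaplacian (Metric.ball 0 r₀) A) μ} =
      Set.range (fun p : ℤ × ℕ => (discEigenvalue B₀ r₀ p.1 p.2 : ℂ)) ∧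
    ∀ μ : ℂ, Module.rank ℂ (eigenspace (magneticDirichletLaplacian (Metric.ball 0 r₀) A) μ) =
      Cardinal.mk {p : ℤ × ℕ // (discEigenvalue B₀ r₀ p.1 p.2 : ℂ) = μ} := by
  have hα : √B₀ * r₀ / √2 ≠ 0 := by positivity
  obtain ⟨E, hE⟩ := exists_isGauge hA hcurl
  have hrank : ∀ μ : ℂ, Module.rank ℂ
      (eigenspace (magneticDirichletLaplacian (Metric.ball 0 r₀) A) μ) =
      Cardinal.mk {p : ℤ × ℕ // (discEigenvalue B₀ r₀ p.1 p.2 : ℂ) = μ} := by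
    intro μ
    -- For nonreal `μ` both sides are zero: the operator is symmetric, and the listed numbers are
    -- real.
    by_cases hμ : (starRingEnd ℂ) μ = μ
    · obtain ⟨ν, rfl⟩ := Complex.conj_eq_iff_real.1 hμ
      rw [hE.rank_eigenspace hB₀ hr₀ hA.continuous, mk_pairs_eq_mk_resonantModes hB₀ hr₀]
    · have h1 : eigenspace (magneticDirichletLaplacian (Metric.ball 0 r₀) A) μ = ⊥ := by
        rw [Submodule.eq_bot_iff]
        intro u hu
        by_contra h0
        exact hμ (conj_eq_of_mem_graph
          ((mem_eigenspace_iff Metric.isOpen_ball hA.continuous).1 hu) h0)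
      have h2 : IsEmpty {p : ℤ × ℕ // (discEigenvalue B₀ r₀ p.1 p.2 : ℂ) = μ} :=
        ⟨fun p => hμ (by rw [← p.2, Complex.conj_ofReal])⟩
      rw [h1, rank_bot, Cardinal.mk_eq_zero]
  refine ⟨fun n => ⟨strictAnti_kummerZero n hα, ?_, fun k =>
    kummerM_zero_neg n _ (kummerM_kummerZero n hα k)⟩, ?_, hrank⟩
  · rw [range_kummerZero n hα, sq_alpha hB₀, div_mul_eq_mul_div]
  · ext μ
    rw [Set.mem_ofPred_eq, isEigenvalue_iff_eigenspace_ne_bot, ne_eq, ← Submodule.rank_eq_zero,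
      hrank, ← ne_eq, Cardinal.mk_ne_zero_iff, nonempty_subtype, Set.mem_range]
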